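/- Theorem 3. Fix $p\ge 0$ and $\beta^*\in\mathbb R^p$. For each $N$ let $(X_i,Y_i)$, $1\le i\le N$, be independent, where the covariates $X_i\in\mathbb R^p$ have a common law not depending on $N$, $Y_i\in\{0,1\}$, and $P(Y_i=1\mid X_i)=p_i(\theta^*)$ with $$p_i(\theta)=\frac{e^{\alpha+X_i^\top\beta}}{1+e^{\alpha+X_i^\top\beta}},\qquad \theta=(\alpha,\beta^\top)^\top\in\mathbb R^{p+1},\qquad \theta^*=\theta^*_N=(\alpha_N^*,\beta^{*\top})^\top .$$ Put $Z_i=(1,X_i^\top)^\top$ and $\Sigma^*=E\{e^{X_i^\top\beta^*}Z_iZ_i^\top\}$, and assume that $\Sigma^*$ is invertible. There are $K=K_N\ge 1$ local computers. Each instance $i$ is allocated to one of them uniformly at random, independently over $i$ and independently of the data; let $a_i^{(k)}\in\{0,1\}$ indicate that it is allocated to computer $k$, so that $P(a_i^{(k)}=1)=1/K$ and $\sum_{k}a_i^{(k)}=1$. Under the COPY strategy, computer $k$ holds all positive instances ($Y_i=1$) and those negative instances ($Y_i=0$) for which $a_i^{(k)}=1$. Let $$\mathcal L(\theta)=\sum_{i=1}^N\big\{Y_i\log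 p_i(\theta)+(1-Y_i)\log(1-p_i(\theta))\big\},$$ $$\mathcal L_{\mathrm{IPW},k}(\theta)=\sum_{i=1}^N\big\{Y_i\log p_i(\theta)+K(1-Y_i)a_i^{(k)}\log(1-p_i(\theta))\big\}$$ be the global log-likelihood and the inverse-probability-weighted local objective. Let $\hat\theta_{\mathrm{GMLE}}=\mathrm{argmax}_\theta\,\mathcal L(\theta)$ and $\hat\theta_{\mathrm{IPW},k}=\mathrm{argmax}_\theta\,\mathcal L_{\mathrm{IPW},k}(\theta)$ (any random vectors that are maximizers whenever a maximizer exists), and let $\hat\theta_{\mathrm{IPW}}=K^{-1}\sum_{k=1}^K\hat\theta_{\mathrm{IPW},k}$ be the one-shot average. With $n=N/K$, assume that - (C1) for some constant $C_{\mathrm{Tail}}>0$, $P(\|Z_i\|>M)\le 2\exp(-C_{\mathrm{Tail}}M^2)$ for all $M\ge 0$; - (C2) $n\to\infty$ as $N\to\infty$; - (C3) $\log^2 N/(ne^{\alpha_N^*})=O(1)$; - $\alpha_N^*\to-\infty$ and $\alpha_N^*+\log N\to\infty$; - $Ke^{\alpha_N^*}=O(1)$, i.e. the number of positive instances on a local computer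 is at most of the order of the number of its negative instances. Then, as $N\to\infty$, $$\sqrt{Ne^{\alpha_N^*}}\,(\hat\theta_{\mathrm{IPW}}-\theta^*)=(Ne^{\alpha_N^*})^{-1/2}\,\Sigma^{*-1}\dot{\mathcal L}(\theta^*)+o_p(1),$$ where $\dot{\mathcal L}$ is the gradient of $\mathcal L$. The global maximum likelihood estimator $\hat\theta_{\mathrm{GMLE}}$ has the same asymptotic linear representation, and hence both estimators have the same asymptotic distribution: $\sqrt{Ne^{\alpha_N^*}}\,(\hat\theta_{\mathrm{IPW}}-\theta^*)$ and $\sqrt{Ne^{\alpha_N^*}}\,(\hat\theta_{\mathrm{GMLE}}-\theta^*)$ both converge in distribution to $N(0,\Sigma^{*-1})$. -/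

import Mathlib

open MeasureTheory ProbabilityTheory Filter Topology Asymptotics

/-- The augmented covariate `Z = (1, Xᵀ)ᵀ ∈ ℝ^{p+1}`, with the Euclidean norm. -/
noncomputable def augment {p : ℕ} (x : EuclideanSpace ℝ (Fin p)) :
    EuclideanSpace ℝ (Fin (p + 1)) :=
  WithLp.toLp 2 (Fin.cons 1 (fun j => x j))

/-- The full parameter `θ = (α, βᵀ)ᵀ ∈ ℝ^{p+1}`. -/
noncomputable def paramOf {p : ℕ} (α : ℝ) (β : EuclideanSpace ℝ (Fin p)) :
    EuclideanSpace ℝ (Fin (p + 1)) :=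
  WithLp.toLp 2 (Fin.cons α (fun j => β j))

/-- The logistic response probability `e^{α + xᵀβ} / (1 + e^{α + xᵀβ})`, where
`α + xᵀβ = Zᵀθ`. -/
noncomputable def responseProb {p : ℕ} (θ : EuclideanSpace ℝ (Fin (p + 1)))
    (x : EuclideanSpace ℝ (Fin p)) : ℝ :=
  Real.exp (inner ℝ (augment x) θ) / (1 + Real.exp (inner ℝ (augment x) θ))

/-- The global log-likelihood of the full data `(x i, y i)`, `i < N`. -/
noncomputable def globalLogLik {p N : ℕ} (x : Fin N → EuclideanSpace ℝ (Fin p)) (y : Fin N → ℝ)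
    (θ : EuclideanSpace ℝ (Fin (p + 1))) : ℝ :=
  ∑ i, (y i * Real.log (responseProb θ (x i)) + (1 - y i) * Real.log (1 - responseProb θ (x i)))

/-- The indicator `a_i^{(k)}` that the `i`-th instance is allocated to the `k`-th computer, when
`c i` is the computer that receives instance `i`. -/
def allocInd {N K : ℕ} (c : Fin N → Fin K) (i : Fin N) (k : Fin K) : ℝ :=
  if c i = k then 1 else 0

/-- The inverse-probability-weighted objective of the `k`-th computer under the COPY strategy:
all positive instances are present with weight one, and the negative instances allocated to
computer `k` have weight `K`. -/
noncomputable def ipwObjective {p N K : ℕ} (x : Fin N → EuclideanSpace ℝ (Fin p))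
    (y : Fin N → ℝ) (c : Fin N → Fin K) (k : Fin K) (θ : EuclideanSpace ℝ (Fin (p + 1))) : ℝ :=
  ∑ i, (y i * Real.log (responseProb θ (x i)) +
    K * (1 - y i) * allocInd c i k * Real.log (1 - responseProb θ (x i)))

/-- `θhat` is an estimator `argmax_θ L(θ)`: a random vector that is a global maximizer of the
random objective `L` whenever a global maximizer exists. -/
def IsArgmaxEstimator {Ω : Type*} [MeasurableSpace Ω] (P : Measure Ω) {d : ℕ}
    (L : Ω → EuclideanSpace ℝ (Fin d) → ℝ) (θhat : Ω → EuclideanSpace ℝ (Fin d)) : Prop :=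
  AEMeasurable θhat P ∧
    ∀ᵐ ω ∂P, (∃ θ, IsMaxOn (L ω) Set.univ θ) → IsMaxOn (L ω) Set.univ (θhat ω)

/-- One-shot averaging of the local estimators. -/
noncomputable def oneShot {d K : ℕ} (θloc : Fin K → EuclideanSpace ℝ (Fin d)) :
    EuclideanSpace ℝ (Fin d) :=
  (K : ℝ)⁻¹ • ∑ k, θloc k

/-- The matrix `Σ* = E(e^{Xᵀβ} Z Zᵀ)`, where `X` has law `ν`. -/
noncomputable def sigmaStar {p : ℕ} (ν : Measure (EuclideanSpace ℝ (Fin p)))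
    (β : EuclideanSpace ℝ (Fin p)) : Matrix (Fin (p + 1)) (Fin (p + 1)) ℝ :=
  Matrix.of fun a b => ∫ x, Real.exp (inner ℝ x β) * augment x a * augment x b ∂ν

/-- The data for total sample size `N` and `K` computers. The pairs `(X i, Y i)` are independent
over `i`, the covariates have law `ν`, the binary response follows the logistic model with
parameter `θ` given the covariate, and each instance is allocated to one of the `K` computers
uniformly at random, independently over the instances and independently of the data. -/
structure IsLogisticSample {Ω : Type*} [MeasurableSpace Ω] (P : Measure Ω) {p N K : ℕ}
    (ν : Measure (EuclideanSpace ℝ (Fin p))) (θ : EuclideanSpace ℝ (Fin (p + 1)))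
    (X : Fin N → Ω → EuclideanSpace ℝ (Fin p)) (Y : Fin N → Ω → ℝ)
    (c : Fin N → Ω → Fin K) : Prop where
  measurable_X : ∀ i, Measurable (X i)
  measurable_Y : ∀ i, Measurable (Y i)
  measurable_c : ∀ i, Measurable (c i)
  indep : iIndepFun (fun i ω => ((X i ω, Y i ω), c i ω)) P
  law_X : ∀ i, P.map (X i) = ν
  binary_Y : ∀ i, ∀ᵐ ω ∂P, Y i ω = 0 ∨ Y i ω = 1
  cond_Y : ∀ i, P[Y i | MeasurableSpace.comap (X i) inferInstance] =ᵐ[P]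
    fun ω => responseProb θ (X i ω)
  indep_c : ∀ i, IndepFun (fun ω => (X i ω, Y i ω)) (c i) P
  uniform_c : ∀ i k, P {ω | c i ω = k} = (K : ENNReal)⁻¹

/-! Every objective here is a weighted logistic log-likelihood, hence concave, and on the scale `r =
N e^α` its negative Hessian at the truth is close to `r Σ*`. A concave function whose score is
nearly affine around the truth, with small initial score, has all its maximizers within a small ball
and given by one Newton step up to an explicit error (`maximizer_expansion`). Applied to one
computer (`IsLogisticSample.local_expansion`), this bounds the gap between `√r (θ̂_k - θ*)` and
`r^{-1/2} Σ*⁻¹ g_k`, where `g_k` is the local score.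

Each instance sits on exactly one computer, so the weights average to one over `k` and the `g_k`
average exactly to the global score (`average_weightedScore_ipwWeight`). It remains to show that the
average of the remainders vanishes. A remainder is a product of the information error with `‖g_k‖ /
√r`, plus `‖g_k‖² / r^{3/2}`. A weighted AM-GM inequality with a free parameter `b` separates the
product, so that only two expectations are needed: the squared information fluctuation is `O(K/N)`,
and `‖g_k‖² / r` is `O(1 + K e^α) = O(1)`. The mean information tends to `Σ*` by dominated
convergence, and `b → 0` is chosen to balance the terms. Expectation is linear, so the dependence
between computers is harmless. The good event must hold for all `k` at once; Markov's inequality and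
a union bound cost `K²/N` and `K/r`, and both vanish because `K/r → 0` and `K e^α = O(1)`
(`tendstoInMeasure_zero_of_average_bound`).

The global estimator is the case of a single computer. For the limit law, the score is a sum of
i.i.d. terms `(Y - π) Z`, and its characteristic function is expanded directly
(`tendsto_scoreCharFun_pow`): the third-order error of one instance carries a factor `e^α`, so the
total error is of order `N e^α r^{-3/2} = r^{-1/2}`. Slutsky's theorem then transfers the limit to
both estimators. -/

/-! ### The logistic function -/

/-- The logistic function `s ↦ eˢ / (1 + eˢ)`. -/
noncomputable def logistic (s : ℝ) : ℝ := Real.exp s / (1 + Real.exp s)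

lemma responseProb_eq_logistic {p : ℕ} (θ : EuclideanSpace ℝ (Fin (p + 1)))
    (x : EuclideanSpace ℝ (Fin p)) :
    responseProb θ x = logistic (inner ℝ (augment x) θ) := rfl

lemma logistic_pos (s : ℝ) : 0 < logistic s := by unfold logistic; positivity

lemma one_sub_logistic (s : ℝ) : 1 - logistic s = (1 + Real.exp s)⁻¹ := by
  have : 1 + Real.exp s ≠ 0 := by positivity
  unfold logistic; field_simp; ring

lemma logistic_lt_one (s : ℝ) : logistic s < 1 := by
  have : 0 < 1 - logistic s := by rw [one_sub_logistic]; positivity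
  linarith

lemma logistic_le_exp (s : ℝ) : logistic s ≤ Real.exp s :=
  div_le_self (Real.exp_pos s).le (by linarith [Real.exp_pos s])

lemma hasDerivAt_log_one_add_exp (s : ℝ) :
    HasDerivAt (fun t => Real.log (1 + Real.exp t)) (logistic s) s :=
  ((Real.hasDerivAt_exp s).const_add 1).log (by positivity)

lemma hasDerivAt_logistic (s : ℝ) :
    HasDerivAt logistic (logistic s * (1 - logistic s)) s := by
  have h0 : 1 + Real.exp s ≠ 0 := by positivity
  have h := (Real.hasDerivAt_exp s).div ((Real.hasDerivAt_exp s).const_add 1) h0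
  refine h.congr_deriv ?_
  rw [one_sub_logistic, logistic]
  field_simp
  ring

lemma continuous_logistic : Continuous logistic :=
  continuous_iff_continuousAt.2 fun s => (hasDerivAt_logistic s).continuousAt

lemma log_logistic (s : ℝ) : Real.log (logistic s) = s - Real.log (1 + Real.exp s) := by
  rw [logistic, Real.log_div (by positivity) (by positivity), Real.log_exp]

lemma log_one_sub_logistic (s : ℝ) : Real.log (1 - logistic s) = -Real.log (1 + Real.exp s) := by
  rw [one_sub_logistic, Real.log_inv]

/-- Convexity of `exp` between `0` and `b - a`, with weight `logistic a`, bounds `exp (logistic a *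
(b - a))` by `(1 + e^b) / (1 + e^a)`; take logarithms. -/
lemma log_one_add_exp_tangent (a b : ℝ) :
    Real.log (1 + Real.exp a) + logistic a * (b - a) ≤ Real.log (1 + Real.exp b) := by
  have h := convexOn_exp.2 (Set.mem_univ 0) (Set.mem_univ (b - a))
    (sub_nonneg.2 (logistic_lt_one a).le) (logistic_pos a).le (by ring)
  simp only [smul_eq_mul, mul_zero, zero_add, Real.exp_zero, mul_one] at h
  have h1 : (1 + Real.exp a) * (1 - logistic a + logistic a * Real.exp (b - a))
      = 1 + Real.exp b := by
    rw [one_sub_logistic, logistic, Real.exp_sub]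
    have : 1 + Real.exp a ≠ 0 := by positivity
    field_simp
  rw [← h1, Real.log_mul (by positivity)
    ((Real.exp_pos _).trans_le h).ne']
  have := Real.log_le_log (Real.exp_pos _) h
  rw [Real.log_exp] at this
  linarith

/-- The second derivative is `σ (1 - σ) (1 - 2σ)`, at most `σ ≤ exp` in absolute value. The
exponential is kept instead of a constant because at the truth it supplies the factor `e^α` of the
rare-event scale. -/
lemma abs_logistic_deriv_sub_le (s h : ℝ) :
    |logistic (s + h) * (1 - logistic (s + h)) - logistic s * (1 - logistic s)|
      ≤ Real.exp (s + |h|) * |h| := by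
  have hd : ∀ x ∈ Metric.closedBall s |h|,
      HasDerivWithinAt (fun t => logistic t * (1 - logistic t))
        (logistic x * (1 - logistic x) * (1 - 2 * logistic x)) (Metric.closedBall s |h|) x := by
    intro x _
    have := (hasDerivAt_logistic x).mul ((hasDerivAt_logistic x).const_sub 1)
    refine (this.congr_deriv ?_).hasDerivWithinAt
    ring
  have hb : ∀ x ∈ Metric.closedBall s |h|,
      ‖logistic x * (1 - logistic x) * (1 - 2 * logistic x)‖ ≤ Real.exp (s + |h|) := by
    intro x hx
    have h0 := logistic_pos x
    have h1 := logistic_lt_one x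
    have h2 : logistic x ≤ Real.exp (s + |h|) := by
      refine (logistic_le_exp x).trans (Real.exp_le_exp.2 ?_)
      have := abs_le.1 (by simpa [Real.dist_eq] using hx : |x - s| ≤ |h|)
      linarith
    rw [norm_mul, norm_mul, Real.norm_of_nonneg h0.le, Real.norm_of_nonneg (sub_nonneg.2 h1.le),
      Real.norm_eq_abs]
    have h3 : |1 - 2 * logistic x| ≤ 1 := abs_le.2 ⟨by linarith, by linarith⟩
    calc logistic x * (1 - logistic x) * |1 - 2 * logistic x|
        ≤ logistic x * 1 * 1 := by gcongr; linarith
      _ ≤ _ := by linarith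
  have := (convex_closedBall s |h|).norm_image_sub_le_of_norm_hasDerivWithin_le hd hb
    (Metric.mem_closedBall_self (abs_nonneg h)) (y := s + h) (by simp)
  simpa using this

/-- Second-order Taylor bound for the logistic function. -/
lemma abs_logistic_taylor_le (s h : ℝ) :
    |logistic (s + h) - logistic s - logistic s * (1 - logistic s) * h|
      ≤ Real.exp (s + |h|) * h ^ 2 := by
  have hd : ∀ x ∈ Metric.closedBall s |h|,
      HasDerivWithinAt (fun t => logistic t - logistic s * (1 - logistic s) * t)
        (logistic x * (1 - logistic x) - logistic s * (1 - logistic s))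
        (Metric.closedBall s |h|) x := by
    intro x _
    have := (hasDerivAt_logistic x).sub
      ((hasDerivAt_id x).const_mul (logistic s * (1 - logistic s)))
    exact (this.congr_deriv (by ring)).hasDerivWithinAt
  have hb : ∀ x ∈ Metric.closedBall s |h|,
      ‖logistic x * (1 - logistic x) - logistic s * (1 - logistic s)‖
        ≤ Real.exp (s + |h|) * |h| := by
    intro x hx
    have hx' : |x - s| ≤ |h| := by simpa [Real.dist_eq] using hx
    have := abs_logistic_deriv_sub_le s (x - s)
    rw [add_sub_cancel] at this
    refine this.trans ?_
    gcongr
  have := (convex_closedBall s |h|).norm_image_sub_le_of_norm_hasDerivWithin_le hd hb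
    (Metric.mem_closedBall_self (abs_nonneg h)) (y := s + h) (by simp)
  simp only [Real.norm_eq_abs, add_sub_cancel_left] at this
  refine le_of_eq_of_le ?_ (this.trans_eq ?_)
  · congr 1
    ring
  · rw [← sq_abs h]
    ring

/-! ### Weighted logistic log-likelihoods -/

section Weighted

variable {ι E : Type*} [Fintype ι] [NormedAddCommGroup E] [InnerProductSpace ℝ E]

/-- The weighted logistic log-likelihood. -/
noncomputable def weightedLogLik (z : ι → E) (y w : ι → ℝ) (θ : E) : ℝ :=
  ∑ i, (y i * inner ℝ (z i) θ - w i * Real.log (1 + Real.exp (inner ℝ (z i) θ)))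

/-- The gradient of the weighted logistic log-likelihood. -/
noncomputable def weightedScore (z : ι → E) (y w : ι → ℝ) (θ : E) : E :=
  ∑ i, (y i - w i * logistic (inner ℝ (z i) θ)) • z i

/-- The negative Hessian of the weighted logistic log-likelihood, as a function. -/
noncomputable def weightedInfo (z : ι → E) (w : ι → ℝ) (θ u : E) : E :=
  ∑ i, (w i * (logistic (inner ℝ (z i) θ) * (1 - logistic (inner ℝ (z i) θ)))
    * inner ℝ (z i) u) • z i

lemma hasGradientAt_weightedLogLik [CompleteSpace E] (z : ι → E) (y w : ι → ℝ) (θ : E) :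
    HasGradientAt (weightedLogLik z y w) (weightedScore z y w θ) θ := by
  rw [hasGradientAt_iff_hasFDerivAt]
  have h : ∀ i, HasFDerivAt
      (fun θ => y i * inner ℝ (z i) θ - w i * Real.log (1 + Real.exp (inner ℝ (z i) θ)))
      ((y i - w i * logistic (inner ℝ (z i) θ)) • innerSL ℝ (z i)) θ := by
    intro i
    have h1 : HasFDerivAt (fun θ : E => inner ℝ (z i) θ) (innerSL ℝ (z i)) θ :=
      (innerSL ℝ (z i)).hasFDerivAt
    have h2 := (hasDerivAt_log_one_add_exp (inner ℝ (z i) θ)).comp_hasFDerivAt θ h1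
    refine ((h1.const_mul (y i)).sub (h2.const_mul (w i))).congr_fderiv ?_
    rw [sub_smul, mul_smul]
  refine (HasFDerivAt.fun_sum fun i _ => h i).congr_fderiv ?_
  ext u
  simp [weightedScore]

/-- Concavity in first-order form: the part weighted by `y` is linear, and nonnegative weights
preserve the tangent inequality of the softplus function. -/
lemma weightedLogLik_le_tangent (z : ι → E) (y : ι → ℝ) {w : ι → ℝ} (hw : ∀ i, 0 ≤ w i)
    (θ θ' : E) :
    weightedLogLik z y w θ' ≤ weightedLogLik z y w θ
      + inner ℝ (weightedScore z y w θ) (θ' - θ) := by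
  unfold weightedLogLik weightedScore
  rw [sum_inner, ← Finset.sum_add_distrib]
  refine Finset.sum_le_sum fun i _ => ?_
  rw [inner_smul_left, inner_sub_right]
  have := mul_le_mul_of_nonneg_left
    (log_one_add_exp_tangent (inner ℝ (z i) θ) (inner ℝ (z i) θ')) (hw i)
  simp only [conj_trivial]
  nlinarith

lemma norm_weightedScore_taylor_le (z : ι → E) (y : ι → ℝ) {w : ι → ℝ} (hw : ∀ i, 0 ≤ w i)
    (θ u : E) (hu : ‖u‖ ≤ 1) :
    ‖weightedScore z y w (θ + u) - weightedScore z y w θ + weightedInfo z w θ u‖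
      ≤ (∑ i, w i * (Real.exp (inner ℝ (z i) θ + ‖z i‖) * ‖z i‖ ^ 3)) * ‖u‖ ^ 2 := by
  unfold weightedScore weightedInfo
  rw [← Finset.sum_sub_distrib, ← Finset.sum_add_distrib, Finset.sum_mul]
  refine (norm_sum_le _ _).trans (Finset.sum_le_sum fun i _ => ?_)
  rw [← sub_smul, ← add_smul, norm_smul, inner_add_right]
  set s := inner ℝ (z i) θ
  set h : ℝ := inner ℝ (z i) u
  have hh : |h| ≤ ‖z i‖ * ‖u‖ := abs_real_inner_le_norm _ _
  have hh1 : |h| ≤ ‖z i‖ := hh.trans (mul_le_of_le_one_right (norm_nonneg _) hu)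
  have e : y i - w i * logistic (s + h) - (y i - w i * logistic s)
      + w i * (logistic s * (1 - logistic s)) * h
      = -(w i * (logistic (s + h) - logistic s - logistic s * (1 - logistic s) * h)) := by ring
  rw [e, norm_neg, norm_mul, Real.norm_of_nonneg (hw i), Real.norm_eq_abs]
  calc w i * |logistic (s + h) - logistic s - logistic s * (1 - logistic s) * h| * ‖z i‖
      ≤ w i * (Real.exp (s + |h|) * |h| ^ 2) * ‖z i‖ := by
        have := abs_logistic_taylor_le s h
        rw [← sq_abs h] at this
        gcongr
        exact hw i
    _ ≤ w i * (Real.exp (s + ‖z i‖) * (‖z i‖ * ‖u‖) ^ 2) * ‖z i‖ := by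
        gcongr
        exact hw i
    _ = _ := by ring

end Weighted

/-! ### A deterministic expansion of maximizers of concave functions -/

section Expansion

variable {E : Type*} [NormedAddCommGroup E] [InnerProductSpace ℝ E] [FiniteDimensional ℝ E]

/-- If the score `G` of a concave function `L` is close to the affine map `u ↦ G θ - H u`
near `θ`, where `H ≈ r S` with `S ≥ lam`, and `G θ` is small, then `L` has a maximizer, and every
maximizer is close to `θ` and approximately given by a Newton step from `θ`. -/
theorem maximizer_expansion {L : E → ℝ} {G H S : E → E} {θ θhat : E} {r η T lam δ : ℝ}
    (hr : 0 < r) (hlam : 0 < lam) (hδ0 : 0 < δ) (hδ1 : δ ≤ 1) (hT : 0 ≤ T)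
    (hgrad : ∀ θ, HasGradientAt L (G θ) θ)
    (hconc : ∀ θ θ', L θ' ≤ L θ + inner ℝ (G θ) (θ' - θ))
    (hTaylor : ∀ u, ‖u‖ ≤ 1 → ‖G (θ + u) - G θ + H u‖ ≤ r * T * ‖u‖ ^ 2)
    (hH : ∀ u, ‖H u - r • S u‖ ≤ r * η * ‖u‖)
    (hS : ∀ u, lam * ‖u‖ ^ 2 ≤ inner ℝ (S u) u)
    (hη : η ≤ lam / 4) (hTδ : T * δ ≤ lam / 4) (hg : ‖G θ‖ < r * δ * (lam / 2))
    (hmax : (∃ θ', IsMaxOn L Set.univ θ') → IsMaxOn L Set.univ θhat) :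
    ‖θhat - θ‖ ≤ 2 / (lam * r) * ‖G θ‖ ∧
      ‖S (θhat - θ) - r⁻¹ • G θ‖ ≤ η * ‖θhat - θ‖ + T * ‖θhat - θ‖ ^ 2 := by
  -- Of the curvature `r * lam`, a quarter is lost to the Taylor error and a quarter to replacing
  -- `H` by `r • S`; half remains.
  have key : ∀ u : E, ‖u‖ ≤ δ → inner ℝ (G (θ + u)) u ≤ ‖G θ‖ * ‖u‖ - r * (lam / 2) * ‖u‖ ^ 2 := by
    intro u hu
    have e : G (θ + u) = G θ + (G (θ + u) - G θ + H u) - (H u - r • S u) - r • S u := by abel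
    rw [e, inner_sub_left, inner_sub_left, inner_add_left, inner_smul_left]
    have h1 : inner ℝ (G θ) u ≤ ‖G θ‖ * ‖u‖ := real_inner_le_norm _ _
    have h2 : inner ℝ (G (θ + u) - G θ + H u) u ≤ r * (lam / 4) * ‖u‖ ^ 2 := by
      refine (real_inner_le_norm _ _).trans ?_
      calc _ ≤ r * T * ‖u‖ ^ 2 * ‖u‖ := by gcongr; exact hTaylor u (hu.trans hδ1)
        _ = r * (T * ‖u‖) * ‖u‖ ^ 2 := by ring
        _ ≤ r * (lam / 4) * ‖u‖ ^ 2 := by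
          gcongr
          exact (mul_le_mul_of_nonneg_left hu hT).trans hTδ
    have h3 : -(r * (lam / 4) * ‖u‖ ^ 2) ≤ inner ℝ (H u - r • S u) u := by
      refine (abs_le.1 ((abs_real_inner_le_norm _ _).trans ?_)).1
      calc _ ≤ r * η * ‖u‖ * ‖u‖ := by gcongr; exact hH u
        _ = r * η * ‖u‖ ^ 2 := by ring
        _ ≤ _ := by gcongr
    have h4 := mul_le_mul_of_nonneg_left (hS u) hr.le
    simp only [conj_trivial]
    nlinarith
  -- Shrink `θ'` radially to the sphere of radius `δ`. There the score points inwards, since `‖G θ‖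
  -- < r δ lam / 2`, so the tangent inequality makes `L` strictly smaller farther out on the ray.
  have out : ∀ θ', δ < ‖θ' - θ‖ → ∃ θ'' ∈ Metric.closedBall θ δ, L θ' < L θ'' := by
    intro θ' hθ'
    have hpos : 0 < ‖θ' - θ‖ := hδ0.trans hθ'
    set t := δ / ‖θ' - θ‖ with ht
    have ht0 : 0 < t := by positivity
    have ht1 : t < 1 := (div_lt_one hpos).2 hθ'
    set u := t • (θ' - θ) with hu
    have hun : ‖u‖ = δ := by
      rw [hu, norm_smul, Real.norm_of_nonneg ht0.le, ht]; field_simp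
    refine ⟨θ + u, by simp [hun], ?_⟩
    have h1 := hconc (θ + u) θ'
    have e : θ' - (θ + u) = (t⁻¹ - 1) • u := by
      rw [sub_smul, one_smul, hu, smul_smul, inv_mul_cancel₀ ht0.ne', one_smul]; abel
    rw [e, inner_smul_right] at h1
    have h2 := key u hun.le
    rw [hun] at h2
    have h3 : inner ℝ (G (θ + u)) u < 0 := by nlinarith
    have h4 : 0 < t⁻¹ - 1 := by
      have := (one_lt_inv₀ ht0).2 ht1
      linarith
    nlinarith
  have hcont : Continuous L := continuous_iff_continuousAt.2 fun x => (hgrad x).continuousAt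
  -- A maximizer over the compact ball is global, as every outside point is beaten by a point of the
  -- ball.
  have hex : ∃ θ', IsMaxOn L Set.univ θ' := by
    obtain ⟨m, hm, hmm⟩ := (isCompact_closedBall θ δ).exists_isMaxOn
      (Metric.nonempty_closedBall.2 hδ0.le) hcont.continuousOn
    refine ⟨m, fun x _ => ?_⟩
    by_cases hx : x ∈ Metric.closedBall θ δ
    · exact hmm hx
    · obtain ⟨x', hx', hlt⟩ := out x (by simpa [dist_eq_norm] using hx)
      exact hlt.le.trans (hmm hx')
  have hM := hmax hex
  have hball : ‖θhat - θ‖ ≤ δ := by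
    by_contra hcon
    obtain ⟨x', -, hlt⟩ := out θhat (not_le.1 hcon)
    exact absurd (hM (Set.mem_univ x')) (not_le.2 hlt)
  have hzero : G θhat = 0 := by
    have := (hM.isLocalMax univ_mem).hasFDerivAt_eq_zero (hgrad θhat).hasFDerivAt
    simpa using this
  set u := θhat - θ with hu
  have hθ : θ + u = θhat := by rw [hu]; abel
  constructor
  · have := key u hball
    rw [hθ, hzero, inner_zero_left] at this
    rcases (norm_nonneg u).eq_or_lt with h0 | h0
    · rw [← h0]; positivity
    · have h1 : r * (lam / 2) * ‖u‖ ≤ ‖G θ‖ := by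
        by_contra hcon
        nlinarith [not_le.1 hcon]
      rw [div_mul_eq_mul_div, le_div_iff₀ (by positivity)]
      linarith
  · have h1 := hTaylor u (hball.trans hδ1)
    rw [hθ, hzero] at h1
    have e : r • (S u - r⁻¹ • G θ) = (0 - G θ + H u) - (H u - r • S u) := by
      rw [smul_sub, smul_smul, mul_inv_cancel₀ hr.ne', one_smul]; abel
    have h2 : r * ‖S u - r⁻¹ • G θ‖ ≤ r * (η * ‖u‖ + T * ‖u‖ ^ 2) := by
      calc r * ‖S u - r⁻¹ • G θ‖ = ‖r • (S u - r⁻¹ • G θ)‖ := by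
            rw [norm_smul, Real.norm_of_nonneg hr.le]
        _ ≤ ‖0 - G θ + H u‖ + ‖H u - r • S u‖ := by rw [e]; exact norm_sub_le _ _
        _ ≤ r * T * ‖u‖ ^ 2 + r * η * ‖u‖ := add_le_add h1 (hH u)
        _ = _ := by ring
    exact le_of_mul_le_mul_left h2 hr

end Expansion

/-! ### Expectations under the logistic sampling model -/

lemma measurable_augment {p : ℕ} : Measurable (augment : EuclideanSpace ℝ (Fin p) → _) := by
  unfold augment
  refine (WithLp.measurable_toLp 2 _).comp (measurable_pi_iff.2 fun j => ?_)
  refine Fin.cases ?_ (fun j => ?_) j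
  · simp
  · simp only [Fin.cons_succ]; fun_prop

lemma measurable_responseProb {p : ℕ} (θ : EuclideanSpace ℝ (Fin (p + 1))) :
    Measurable (responseProb θ) :=
  continuous_logistic.measurable.comp (measurable_augment.inner measurable_const)

lemma responseProb_pos {p : ℕ} (θ : EuclideanSpace ℝ (Fin (p + 1)))
    (x : EuclideanSpace ℝ (Fin p)) : 0 < responseProb θ x := logistic_pos _

lemma responseProb_lt_one {p : ℕ} (θ : EuclideanSpace ℝ (Fin (p + 1)))
    (x : EuclideanSpace ℝ (Fin p)) : responseProb θ x < 1 := logistic_lt_one _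

lemma integrable_responseProb_smul {p : ℕ} {ν : Measure (EuclideanSpace ℝ (Fin p))}
    {E : Type*} [NormedAddCommGroup E] [NormedSpace ℝ E]
    (θ : EuclideanSpace ℝ (Fin (p + 1))) {u : EuclideanSpace ℝ (Fin p) → E}
    (hu : Integrable u ν) : Integrable (fun x => responseProb θ x • u x) ν :=
  hu.bdd_smul 1 (measurable_responseProb θ).aestronglyMeasurable
    (ae_of_all _ fun x => by
      rw [Real.norm_of_nonneg (responseProb_pos θ x).le]; exact (responseProb_lt_one θ x).le)

namespace IsLogisticSample

variable {Ω : Type*} [MeasurableSpace Ω] {P : Measure Ω} {p N K : ℕ}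
  {ν : Measure (EuclideanSpace ℝ (Fin p))} {θ : EuclideanSpace ℝ (Fin (p + 1))}
  {X : Fin N → Ω → EuclideanSpace ℝ (Fin p)} {Y : Fin N → Ω → ℝ} {c : Fin N → Ω → Fin K}

lemma integrable_comp {E : Type*} [NormedAddCommGroup E]
    (h : IsLogisticSample P ν θ X Y c) (i : Fin N)
    {u : EuclideanSpace ℝ (Fin p) → E} (hu : Integrable u ν) :
    Integrable (fun ω => u (X i ω)) P := by
  rw [← h.law_X i] at hu
  exact hu.comp_measurable (h.measurable_X i)

lemma integral_comp {E : Type*} [NormedAddCommGroup E] [NormedSpace ℝ E]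
    (h : IsLogisticSample P ν θ X Y c) (i : Fin N)
    {u : EuclideanSpace ℝ (Fin p) → E} (hu : Integrable u ν) :
    ∫ ω, u (X i ω) ∂P = ∫ x, u x ∂ν := by
  have := hu.aestronglyMeasurable
  rw [← h.law_X i] at this ⊢
  rw [integral_map (h.measurable_X i).aemeasurable this]

lemma integrable_Y [IsProbabilityMeasure P] (h : IsLogisticSample P ν θ X Y c) (i : Fin N) : Integrable (Y i) P := by
  refine Integrable.of_bound (h.measurable_Y i).aestronglyMeasurable 1 ?_
  filter_upwards [h.binary_Y i] with ω hω
  rcases hω with h0 | h0 <;> simp [h0]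

lemma integrable_Y_smul [IsProbabilityMeasure P] {E : Type*} [NormedAddCommGroup E] [NormedSpace ℝ E]
    (h : IsLogisticSample P ν θ X Y c) (i : Fin N)
    {u : EuclideanSpace ℝ (Fin p) → E} (hu : Integrable u ν) :
    Integrable (fun ω => Y i ω • u (X i ω)) P := by
  refine (h.integrable_comp i hu).bdd_smul 1 (h.measurable_Y i).aestronglyMeasurable ?_
  filter_upwards [h.binary_Y i] with ω hω
  rcases hω with h0 | h0 <;> simp [h0]

/-- Tower property: conditionally on the covariate, `u (X i)` factors out and `Y i` is replaced by
its response probability. -/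
lemma integral_Y_smul [IsProbabilityMeasure P] {E : Type*} [NormedAddCommGroup E] [NormedSpace ℝ E] [CompleteSpace E]
    (h : IsLogisticSample P ν θ X Y c) (i : Fin N)
    {u : EuclideanSpace ℝ (Fin p) → E} (hum : StronglyMeasurable u) (hu : Integrable u ν) :
    ∫ ω, Y i ω • u (X i ω) ∂P = ∫ x, responseProb θ x • u x ∂ν := by
  have hm := (h.measurable_X i).comap_le
  have h1 : P[Y i • (fun ω => u (X i ω)) | MeasurableSpace.comap (X i) inferInstance] =ᵐ[P]
      P[Y i | MeasurableSpace.comap (X i) inferInstance] • fun ω => u (X i ω) :=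
    condExp_smul_of_aestronglyMeasurable_right (h.integrable_Y i)
      (h.integrable_Y_smul i hu)
      (hum.comp_measurable (comap_measurable (X i))).aestronglyMeasurable
  calc ∫ ω, Y i ω • u (X i ω) ∂P
      = ∫ ω, (P[Y i • (fun ω => u (X i ω)) |
          MeasurableSpace.comap (X i) inferInstance]) ω ∂P := (integral_condExp hm).symm
    _ = ∫ ω, responseProb θ (X i ω) • u (X i ω) ∂P := by
        refine integral_congr_ae ?_
        filter_upwards [h1, h.cond_Y i] with ω h2 h3
        rw [h2, Pi.smul_apply', h3]
    _ = _ := h.integral_comp i (integrable_responseProb_smul θ hu)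

lemma measurable_allocInd (h : IsLogisticSample P ν θ X Y c) (i : Fin N) (k : Fin K) :
    Measurable (fun ω => allocInd (fun i => c i ω) i k) :=
  (measurable_of_countable (fun j : Fin K => if j = k then (1 : ℝ) else 0)).comp
    (h.measurable_c i)

lemma integral_allocInd (h : IsLogisticSample P ν θ X Y c) (i : Fin N) (k : Fin K) :
    ∫ ω, allocInd (fun i => c i ω) i k ∂P = (K : ℝ)⁻¹ := by
  have hm : MeasurableSet {ω | c i ω = k} := h.measurable_c i (measurableSet_singleton k)
  have : (fun ω => allocInd (fun i => c i ω) i k) = {ω | c i ω = k}.indicator 1 := by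
    ext ω; simp [allocInd, Set.indicator_apply]
  rw [this, integral_indicator_one hm, measureReal_def, h.uniform_c]
  simp

lemma abs_allocInd_le {N K : ℕ} (c : Fin N → Fin K) (i : Fin N) (k : Fin K) :
    ‖allocInd c i k‖ ≤ 1 := by
  unfold allocInd; split_ifs <;> simp

lemma integrable_neg_alloc [IsProbabilityMeasure P] (h : IsLogisticSample P ν θ X Y c) (i : Fin N) (k : Fin K)
    {v : EuclideanSpace ℝ (Fin p) → ℝ} (hv : Integrable v ν) :
    Integrable (fun ω => (K : ℝ) * ((1 - Y i ω) * v (X i ω))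
      * allocInd (fun i => c i ω) i k) P := by
  have h1 : Integrable (fun ω => (K : ℝ) * ((1 - Y i ω) * v (X i ω))) P := by
    refine Integrable.const_mul ?_ _
    have := (h.integrable_comp i hv).sub (h.integrable_Y_smul i hv)
    refine this.congr (ae_of_all _ fun ω => ?_)
    simp only [Pi.sub_apply, smul_eq_mul]; ring
  exact h1.mul_bdd (c := 1) (h.measurable_allocInd i k).aestronglyMeasurable
    (ae_of_all _ fun ω => abs_allocInd_le _ i k)

/-- Unbiasedness of the inverse-probability weight: the allocation is independent of the data and
its probability `1/K` cancels `K`. -/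
lemma integral_neg_alloc [IsProbabilityMeasure P] (h : IsLogisticSample P ν θ X Y c) (hK : 0 < K) (i : Fin N) (k : Fin K)
    {v : EuclideanSpace ℝ (Fin p) → ℝ} (hvm : Measurable v) (hv : Integrable v ν) :
    ∫ ω, (K : ℝ) * ((1 - Y i ω) * v (X i ω)) * allocInd (fun i => c i ω) i k ∂P
      = ∫ x, (1 - responseProb θ x) * v x ∂ν := by
  have hind : IndepFun (fun ω => (K : ℝ) * ((1 - Y i ω) * v (X i ω)))
      (fun ω => allocInd (fun i => c i ω) i k) P :=
    (h.indep_c i).comp (φ := fun q : EuclideanSpace ℝ (Fin p) × ℝ => (K : ℝ) * ((1 - q.2) * v q.1))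
      (ψ := fun j : Fin K => if j = k then (1 : ℝ) else 0) (by fun_prop)
      (measurable_of_countable _)
  have hmX := h.measurable_X i
  have hmY := h.measurable_Y i
  rw [hind.integral_fun_mul_eq_mul_integral (by fun_prop)
    (h.measurable_allocInd i k).aestronglyMeasurable, h.integral_allocInd, integral_const_mul]
  have e : (fun ω => (1 - Y i ω) * v (X i ω)) = fun ω => v (X i ω) - Y i ω • v (X i ω) := by
    ext ω; simp only [smul_eq_mul]; ring
  rw [e, integral_sub (h.integrable_comp i hv) (h.integrable_Y_smul i hv),
    h.integral_Y_smul i hvm.stronglyMeasurable hv, h.integral_comp i hv,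
    ← integral_sub hv (integrable_responseProb_smul θ hv)]
  have hK' : (K : ℝ) ≠ 0 := by positivity
  rw [mul_comm, ← mul_assoc, inv_mul_cancel₀ hK', one_mul]
  refine integral_congr_ae (ae_of_all _ fun x => ?_)
  simp only [smul_eq_mul]; ring

variable (Y c X) in
/-- A term of a sum over the sample held by computer `k`: `u` at a positive instance, and `v`
with inverse-probability weight at a negative one. -/
def localTerm (k : Fin K) (u v : EuclideanSpace ℝ (Fin p) → ℝ) (i : Fin N) (ω : Ω) : ℝ :=
  Y i ω * u (X i ω) + (K : ℝ) * ((1 - Y i ω) * v (X i ω)) * allocInd (fun i => c i ω) i k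

lemma measurable_localTerm (h : IsLogisticSample P ν θ X Y c) (k : Fin K)
    {u v : EuclideanSpace ℝ (Fin p) → ℝ} (hu : Measurable u) (hv : Measurable v) (i : Fin N) :
    Measurable (localTerm X Y c k u v i) := by
  have hmX := h.measurable_X i
  have hmY := h.measurable_Y i
  have := h.measurable_allocInd i k
  unfold localTerm
  fun_prop

lemma integrable_localTerm [IsProbabilityMeasure P] (h : IsLogisticSample P ν θ X Y c) (k : Fin K)
    {u v : EuclideanSpace ℝ (Fin p) → ℝ} (hu : Integrable u ν) (hv : Integrable v ν) (i : Fin N) :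
    Integrable (localTerm X Y c k u v i) P :=
  (h.integrable_Y_smul i hu).add (h.integrable_neg_alloc i k hv)

lemma integral_localTerm [IsProbabilityMeasure P] (h : IsLogisticSample P ν θ X Y c) (hK : 0 < K) (k : Fin K)
    {u v : EuclideanSpace ℝ (Fin p) → ℝ} (hum : Measurable u) (hvm : Measurable v)
    (hu : Integrable u ν) (hv : Integrable v ν) (i : Fin N) :
    ∫ ω, localTerm X Y c k u v i ω ∂P
      = ∫ x, (responseProb θ x * u x + (1 - responseProb θ x) * v x) ∂ν := by
  unfold localTerm
  have h1 := h.integrable_Y_smul i hu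
  have h2 := integrable_responseProb_smul θ hv
  have h3 := integrable_responseProb_smul θ hu
  simp only [smul_eq_mul] at h1 h2 h3
  rw [integral_add h1 (h.integrable_neg_alloc i k hv), h.integral_neg_alloc hK i k hvm hv,
    integral_add h3]
  · congr 1
    exact h.integral_Y_smul i hum.stronglyMeasurable hu
  · refine (hv.sub h2).congr (ae_of_all _ fun x => ?_)
    simp only [Pi.sub_apply]; ring

/-- For a binary response the cross term vanishes and indicators are idempotent. The second moment
of a local term is thus again the mean of a local term, and weighting inflates only the negative
part, by one factor `K`. -/
lemma localTerm_sq (h : IsLogisticSample P ν θ X Y c) (k : Fin K)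
    (u v : EuclideanSpace ℝ (Fin p) → ℝ) (i : Fin N) :
    (fun ω => localTerm X Y c k u v i ω ^ 2) =ᵐ[P]
      localTerm X Y c k (fun x => u x ^ 2) (fun x => K * v x ^ 2) i := by
  filter_upwards [h.binary_Y i] with ω hω
  unfold localTerm allocInd
  rcases hω with h0 | h0 <;> split_ifs <;> simp [h0]
  ring

lemma memLp_localTerm [IsProbabilityMeasure P] (h : IsLogisticSample P ν θ X Y c) (k : Fin K)
    {u v : EuclideanSpace ℝ (Fin p) → ℝ} (hum : Measurable u) (hvm : Measurable v)
    (hu : Integrable (fun x => u x ^ 2) ν) (hv : Integrable (fun x => v x ^ 2) ν) (i : Fin N) :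
    MemLp (localTerm X Y c k u v i) 2 P := by
  rw [memLp_two_iff_integrable_sq (h.measurable_localTerm k hum hvm i).aestronglyMeasurable]
  exact (h.integrable_localTerm k hu (hv.const_mul _) i).congr (h.localTerm_sq k u v i).symm

lemma memLp_sum_localTerm [IsProbabilityMeasure P] (h : IsLogisticSample P ν θ X Y c) (k : Fin K)
    {u v : EuclideanSpace ℝ (Fin p) → ℝ} (hum : Measurable u) (hvm : Measurable v)
    (hu : Integrable (fun x => u x ^ 2) ν) (hv : Integrable (fun x => v x ^ 2) ν) :
    MemLp (fun ω => ∑ i, localTerm X Y c k u v i ω) 2 P :=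
  memLp_finsetSum _ fun i _ => h.memLp_localTerm k hum hvm hu hv i

/-- The mean squared deviation of a local sum from its mean. -/
lemma integral_sq_sum_localTerm_le [IsProbabilityMeasure P] [IsProbabilityMeasure ν]
    (h : IsLogisticSample P ν θ X Y c) (hK : 0 < K) (k : Fin K)
    {u v : EuclideanSpace ℝ (Fin p) → ℝ} (hum : Measurable u) (hvm : Measurable v)
    (hu : Integrable (fun x => u x ^ 2) ν) (hv : Integrable (fun x => v x ^ 2) ν) :
    ∫ ω, (∑ i, localTerm X Y c k u v i ω
        - N * ∫ x, (responseProb θ x * u x + (1 - responseProb θ x) * v x) ∂ν) ^ 2 ∂P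
      ≤ N * ∫ x, (responseProb θ x * u x ^ 2
          + (1 - responseProb θ x) * (K * v x ^ 2)) ∂ν := by
  have hu1 : Integrable u ν := ((memLp_two_iff_integrable_sq
    hum.aestronglyMeasurable).2 hu).integrable (by norm_num)
  have hv1 : Integrable v ν := ((memLp_two_iff_integrable_sq
    hvm.aestronglyMeasurable).2 hv).integrable (by norm_num)
  have hL := h.memLp_localTerm k hum hvm hu hv
  have hmean : ∫ ω, ∑ i, localTerm X Y c k u v i ω ∂P
      = N * ∫ x, (responseProb θ x * u x + (1 - responseProb θ x) * v x) ∂ν := by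
    rw [integral_finsetSum _ fun i _ => h.integrable_localTerm k hu1 hv1 i]
    simp [h.integral_localTerm hK k hum hvm hu1 hv1]
  have hindep : iIndepFun (fun i => localTerm X Y c k u v i) P := by
    refine h.indep.comp (fun _ q => q.1.2 * u q.1.1 + (K : ℝ) * ((1 - q.1.2) * v q.1.1)
      * (if q.2 = k then (1 : ℝ) else 0)) fun i => ?_
    have : Measurable (fun j : Fin K => if j = k then (1 : ℝ) else 0) := measurable_of_countable _
    have h2 : Measurable (fun q : (EuclideanSpace ℝ (Fin p) × ℝ) × Fin K =>
        if q.2 = k then (1 : ℝ) else 0) := this.comp measurable_snd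
    fun_prop
  rw [← hmean, ← variance_eq_integral (h.memLp_sum_localTerm k hum hvm hu hv).aemeasurable,
    show (fun ω => ∑ i, localTerm X Y c k u v i ω) = ∑ i, localTerm X Y c k u v i by
      ext; simp,
    IndepFun.variance_sum (fun i _ => hL i) fun i _ j _ hij => hindep.indepFun hij]
  calc ∑ i, variance (localTerm X Y c k u v i) P
      ≤ ∑ _i : Fin N, ∫ x, (responseProb θ x * u x ^ 2
          + (1 - responseProb θ x) * (K * v x ^ 2)) ∂ν := by
        refine Finset.sum_le_sum fun i _ => ?_
        refine (variance_le_expectation_sq (hL i).aestronglyMeasurable).trans_eq ?_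
        rw [← h.integral_localTerm hK k (hum.pow_const 2) ((hvm.pow_const 2).const_mul _) hu
          (hv.const_mul _) i]
        exact integral_congr_ae (h.localTerm_sq k u v i)
    _ = _ := by simp

end IsLogisticSample

/-! ### Exponential moments of the augmented covariate -/

/-- Slice by integer levels: the exponential is at most `1 + ∑ exp (t (m + 1)) 1{m < f}`, and the
Gaussian tail makes the integrated series summable. -/
lemma integrable_exp_of_subGaussian_tail {α : Type*} [MeasurableSpace α] {μ : Measure α}
    [IsFiniteMeasure μ] {f : α → ℝ} (hf : Measurable f) {C : ℝ} (hC : 0 < C)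
    (htail : ∀ M : ℝ, 0 ≤ M → μ.real {x | M < f x} ≤ 2 * Real.exp (-C * M ^ 2))
    {t : ℝ} (ht : 0 ≤ t) : Integrable (fun x => Real.exp (t * f x)) μ := by
  refine ⟨by fun_prop, ?_⟩
  rw [hasFiniteIntegral_iff_ofReal (ae_of_all _ fun x => (Real.exp_pos _).le)]
  have hpt : ∀ x, ENNReal.ofReal (Real.exp (t * f x)) ≤ 1 + ∑' m : ℕ,
      {x | (m : ℝ) < f x}.indicator (fun _ => ENNReal.ofReal (Real.exp (t * (m + 1)))) x := by
    intro x
    rcases le_or_gt (f x) 0 with h0 | h0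
    · refine le_add_right ?_
      rw [← ENNReal.ofReal_one]
      exact ENNReal.ofReal_le_ofReal (Real.exp_le_one_iff.2 (mul_nonpos_of_nonneg_of_nonpos ht h0))
    -- The index `m = ⌈f x⌉₊ - 1` satisfies `m < f x ≤ m + 1`, so this single term of the series
    -- suffices.
    · refine le_add_left ((le_trans ?_) (ENNReal.le_tsum (⌈f x⌉₊ - 1)))
      have h1 : 0 < ⌈f x⌉₊ := Nat.ceil_pos.2 h0
      have h2 : ((⌈f x⌉₊ - 1 : ℕ) : ℝ) < f x := by
        rw [← Nat.lt_ceil]; omega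
      rw [Set.indicator_of_mem (by exact h2)]
      refine ENNReal.ofReal_le_ofReal (Real.exp_le_exp.2 (mul_le_mul_of_nonneg_left ?_ ht))
      rw [Nat.cast_sub h1]
      simpa using Nat.le_ceil (f x)
  have hset : ∀ m : ℕ, MeasurableSet {x | (m : ℝ) < f x} :=
    fun m => measurableSet_lt measurable_const hf
  refine (lintegral_mono hpt).trans_lt ?_
  rw [lintegral_add_left measurable_const, lintegral_tsum fun m =>
    (measurable_const.indicator (hset m)).aemeasurable]
  refine ENNReal.add_lt_top.2 ⟨by simp, ?_⟩
  simp_rw [lintegral_indicator_const (hset _)]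
  have hb : ∀ m : ℕ, ENNReal.ofReal (Real.exp (t * (m + 1))) * μ {x | (m : ℝ) < f x}
      ≤ ENNReal.ofReal (2 * Real.exp (t + (t + 1) ^ 2 / (4 * C)) * Real.exp (-m)) := by
    intro m
    rw [← ofReal_measureReal, ← ENNReal.ofReal_mul (Real.exp_pos _).le]
    refine ENNReal.ofReal_le_ofReal ?_
    calc Real.exp (t * (m + 1)) * μ.real {x | (m : ℝ) < f x}
        ≤ Real.exp (t * (m + 1)) * (2 * Real.exp (-C * m ^ 2)) := by
          gcongr; exact htail m m.cast_nonneg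
      _ = 2 * Real.exp (t * (m + 1) + -C * m ^ 2) := by rw [Real.exp_add]; ring
      _ ≤ 2 * Real.exp (t + (t + 1) ^ 2 / (4 * C) + -m) := by
          refine mul_le_mul_of_nonneg_left (Real.exp_le_exp.2 ?_) zero_le_two
          -- Completing the square with `t + 1` in place of `t` leaves a spare `exp (-m)`, which
          -- gives summability.
          have : (t + 1) ^ 2 / (4 * C) = (t + 1) * m - C * m ^ 2
              + C * (m - (t + 1) / (2 * C)) ^ 2 := by field_simp; ring
          have h2 : 0 ≤ C * (m - (t + 1) / (2 * C)) ^ 2 := by positivity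
          linarith
      _ = _ := by rw [Real.exp_add]; ring
  refine (ENNReal.tsum_le_tsum hb).trans_lt ?_
  have hs : Summable fun m : ℕ =>
      2 * Real.exp (t + (t + 1) ^ 2 / (4 * C)) * Real.exp (-(m : ℝ)) :=
    Real.summable_exp_neg_nat.mul_left _
  rw [← ENNReal.ofReal_tsum_of_nonneg (fun m => by positivity) hs]
  exact ENNReal.ofReal_lt_top

section Augment

variable {p : ℕ}

lemma augment_zero (x : EuclideanSpace ℝ (Fin p)) : augment x 0 = 1 := rfl

lemma augment_succ (x : EuclideanSpace ℝ (Fin p)) (j : Fin p) : augment x j.succ = x j := rfl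

lemma inner_augment_paramOf (x : EuclideanSpace ℝ (Fin p)) (α : ℝ)
    (β : EuclideanSpace ℝ (Fin p)) : inner ℝ (augment x) (paramOf α β) = α + inner ℝ x β := by
  simp [PiLp.inner_apply, Fin.sum_univ_succ, augment, paramOf]

lemma norm_augment_sq (x : EuclideanSpace ℝ (Fin p)) : ‖augment x‖ ^ 2 = 1 + ‖x‖ ^ 2 := by
  simp [EuclideanSpace.norm_sq_eq, Fin.sum_univ_succ, augment_zero, augment_succ]

lemma one_le_norm_augment (x : EuclideanSpace ℝ (Fin p)) : 1 ≤ ‖augment x‖ := by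
  nlinarith [norm_augment_sq x, norm_nonneg (augment x), sq_nonneg ‖x‖]

lemma norm_le_norm_augment (x : EuclideanSpace ℝ (Fin p)) : ‖x‖ ≤ ‖augment x‖ :=
  abs_le_of_sq_le_sq' (by rw [norm_augment_sq]; linarith) (norm_nonneg _) |>.2

lemma measurable_augment_apply (a : Fin (p + 1)) :
    Measurable (fun x : EuclideanSpace ℝ (Fin p) => augment x a) := by
  have := measurable_augment (p := p)
  fun_prop

lemma abs_augment_le (x : EuclideanSpace ℝ (Fin p)) (a : Fin (p + 1)) :
    |augment x a| ≤ ‖augment x‖ := PiLp.norm_apply_le (augment x) a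

lemma responseProb_paramOf_le (α : ℝ) (β x : EuclideanSpace ℝ (Fin p)) :
    responseProb (paramOf α β) x ≤ Real.exp α * Real.exp (inner ℝ x β) := by
  rw [responseProb_eq_logistic, inner_augment_paramOf, ← Real.exp_add]
  exact logistic_le_exp _

/-- A dominating function for all moments in the analysis. -/
noncomputable def envelope (β x : EuclideanSpace ℝ (Fin p)) : ℝ :=
  6 * Real.exp ((‖β‖ + 2) * ‖augment x‖)

lemma envelope_pos (β x : EuclideanSpace ℝ (Fin p)) : 0 < envelope β x := by
  unfold envelope; positivity

lemma measurable_envelope (β : EuclideanSpace ℝ (Fin p)) : Measurable (envelope β) := by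
  have := measurable_augment (p := p)
  unfold envelope; fun_prop

/-- The cube is absorbed by `z ^ 3 ≤ 6 * exp z`, whence the constant `6`; this exponential and the
one from a unit displacement of the parameter make up the `2` in the exponent. -/
lemma exp_inner_add_norm_mul_le_envelope (β x : EuclideanSpace ℝ (Fin p)) :
    Real.exp (inner ℝ x β + ‖augment x‖) * ‖augment x‖ ^ 3 ≤ envelope β x := by
  have h1 : ‖augment x‖ ^ 3 ≤ 6 * Real.exp ‖augment x‖ := by
    have := Real.pow_div_factorial_le_exp ‖augment x‖ (norm_nonneg _) 3
    rw [div_le_iff₀ (by positivity)] at this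
    have h6 : ((Nat.factorial 3 : ℕ) : ℝ) = 6 := by norm_num [Nat.factorial]
    rw [h6] at this
    linarith
  have h2 : inner ℝ x β ≤ ‖β‖ * ‖augment x‖ := by
    refine (real_inner_le_norm x β).trans ?_
    rw [mul_comm]
    gcongr
    exact norm_le_norm_augment x
  calc Real.exp (inner ℝ x β + ‖augment x‖) * ‖augment x‖ ^ 3
      ≤ Real.exp (‖β‖ * ‖augment x‖ + ‖augment x‖) * (6 * Real.exp ‖augment x‖) := by gcongr
    _ = envelope β x := by
        rw [mul_left_comm, ← Real.exp_add, envelope]; congr 2; ring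

lemma exp_inner_mul_le_envelope (β x : EuclideanSpace ℝ (Fin p)) {j : ℕ} (hj : j ≤ 3) :
    Real.exp (inner ℝ x β) * ‖augment x‖ ^ j ≤ envelope β x := by
  refine le_trans ?_ (exp_inner_add_norm_mul_le_envelope β x)
  gcongr
  · linarith [norm_nonneg (augment x)]
  · exact one_le_norm_augment x

variable {ν : Measure (EuclideanSpace ℝ (Fin p))} [IsProbabilityMeasure ν] {C : ℝ}

lemma integrable_envelope (hC : 0 < C)
    (htail : ∀ M : ℝ, 0 ≤ M → ν.real {x | M < ‖augment x‖} ≤ 2 * Real.exp (-C * M ^ 2))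
    (β : EuclideanSpace ℝ (Fin p)) : Integrable (envelope β) ν :=
  (integrable_exp_of_subGaussian_tail measurable_augment.norm hC htail
    (by positivity)).const_mul 6

lemma integrable_envelope_sq (hC : 0 < C)
    (htail : ∀ M : ℝ, 0 ≤ M → ν.real {x | M < ‖augment x‖} ≤ 2 * Real.exp (-C * M ^ 2))
    (β : EuclideanSpace ℝ (Fin p)) : Integrable (fun x => envelope β x ^ 2) ν := by
  refine ((integrable_exp_of_subGaussian_tail measurable_augment.norm hC htail
    (t := 2 * (‖β‖ + 2)) (by positivity)).const_mul 36).congr (ae_of_all _ fun x => ?_)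
  simp only [envelope, mul_pow, ← Real.exp_nat_mul]
  norm_num
  ring_nf

end Augment

/-! ### The limiting information matrix -/

section Sigma

variable {p : ℕ} {ν : Measure (EuclideanSpace ℝ (Fin p))} {β : EuclideanSpace ℝ (Fin p)}

/-- With `π` the response probability, `e^{-α} π (1 - π) = e^{xᵀβ} (1 + e^{α + xᵀβ})⁻²`, which is
dominated by `e^{xᵀβ}` and converges to it as `α → -∞`. -/
lemma tendsto_scaled_information {α : ℕ → ℝ} (hα : Tendsto α atTop atBot)
    {f : EuclideanSpace ℝ (Fin p) → ℝ} (hf : Measurable f)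
    (hfi : Integrable (fun x => Real.exp (inner ℝ x β) * f x) ν) :
    Tendsto (fun N => (Real.exp (α N))⁻¹ * ∫ x, responseProb (paramOf (α N) β) x
        * (1 - responseProb (paramOf (α N) β) x) * f x ∂ν) atTop
      (𝓝 (∫ x, Real.exp (inner ℝ x β) * f x ∂ν)) := by
  simp_rw [← integral_const_mul]
  refine tendsto_integral_of_dominated_convergence
    (fun x => ‖Real.exp (inner ℝ x β) * f x‖) (fun N => ?_) hfi.norm (fun N => ?_) ?_
  · have := measurable_responseProb (paramOf (α N) β)
    exact Measurable.aestronglyMeasurable (by fun_prop)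
  · refine ae_of_all _ fun x => ?_
    have h0 := responseProb_pos (paramOf (α N) β) x
    have h1 := responseProb_lt_one (paramOf (α N) β) x
    have h2 := responseProb_paramOf_le (α N) β x
    rw [norm_mul, norm_mul, norm_mul, norm_mul, Real.norm_of_nonneg (Real.exp_pos _).le,
      Real.norm_of_nonneg h0.le, Real.norm_of_nonneg (sub_nonneg.2 h1.le),
      Real.norm_of_nonneg (inv_nonneg.2 (Real.exp_pos _).le), ← mul_assoc]
    gcongr
    rw [inv_mul_le_iff₀ (Real.exp_pos _)]
    nlinarith
  · refine ae_of_all _ fun x => ?_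
    have he : Tendsto (fun N => Real.exp (α N)) atTop (𝓝 0) := Real.tendsto_exp_atBot.comp hα
    have h1 : Tendsto (fun N => Real.exp (inner ℝ x β)
        * ((1 + Real.exp (α N) * Real.exp (inner ℝ x β))⁻¹) ^ 2 * f x) atTop
        (𝓝 (Real.exp (inner ℝ x β) * ((1 + 0 * Real.exp (inner ℝ x β))⁻¹) ^ 2 * f x)) := by
      refine Tendsto.mul_const _ (Tendsto.const_mul _ (Tendsto.pow (Tendsto.inv₀ ?_ ?_) 2))
      · exact (he.mul_const _).const_add 1
      · simp
    simp only [zero_mul, add_zero, inv_one, one_pow, mul_one] at h1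
    refine h1.congr fun N => ?_
    rw [responseProb_eq_logistic, one_sub_logistic, logistic, inner_augment_paramOf, Real.exp_add]
    have : 1 + Real.exp (α N) * Real.exp (inner ℝ x β) ≠ 0 := by positivity
    field_simp

lemma integrable_exp_mul_augment (henv : Integrable (envelope β) ν) (a b : Fin (p + 1)) :
    Integrable (fun x => Real.exp (inner ℝ x β) * (augment x a * augment x b)) ν := by
  have ha := measurable_augment_apply a
  have hb := measurable_augment_apply b
  refine henv.mono' (by fun_prop) (ae_of_all _ fun x => ?_)
  refine le_trans ?_ (exp_inner_mul_le_envelope β x (j := 2) (by norm_num))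
  rw [norm_mul, norm_mul, Real.norm_of_nonneg (Real.exp_pos _).le, sq]
  gcongr
  · exact abs_augment_le x a
  · exact abs_augment_le x b

lemma sigmaStar_apply (a b : Fin (p + 1)) :
    sigmaStar ν β a b = ∫ x, Real.exp (inner ℝ x β) * (augment x a * augment x b) ∂ν := by
  simp [sigmaStar, mul_assoc]

lemma inner_augment_eq (x : EuclideanSpace ℝ (Fin p)) (u : EuclideanSpace ℝ (Fin (p + 1))) :
    inner ℝ (augment x) u = ∑ a, u a * augment x a := by
  simp [PiLp.inner_apply]

lemma exp_mul_inner_sq_eq (x : EuclideanSpace ℝ (Fin p)) (u : EuclideanSpace ℝ (Fin (p + 1))) :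
    Real.exp (inner ℝ x β) * inner ℝ (augment x) u ^ 2
      = ∑ a, ∑ b, u a * u b * (Real.exp (inner ℝ x β) * (augment x a * augment x b)) := by
  rw [inner_augment_eq, sq, Finset.sum_mul_sum, Finset.mul_sum]
  refine Finset.sum_congr rfl fun a _ => ?_
  rw [Finset.mul_sum]
  refine Finset.sum_congr rfl fun b _ => ?_
  ring

lemma integrable_exp_mul_inner_sq (henv : Integrable (envelope β) ν)
    (u : EuclideanSpace ℝ (Fin (p + 1))) :
    Integrable (fun x => Real.exp (inner ℝ x β) * inner ℝ (augment x) u ^ 2) ν := by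
  simp_rw [exp_mul_inner_sq_eq]
  exact integrable_finsetSum _ fun a _ => integrable_finsetSum _ fun b _ =>
    (integrable_exp_mul_augment henv a b).const_mul _

lemma dotProduct_sigmaStar (henv : Integrable (envelope β) ν)
    (u : EuclideanSpace ℝ (Fin (p + 1))) :
    u.ofLp ⬝ᵥ (sigmaStar ν β).mulVec u.ofLp
      = ∫ x, Real.exp (inner ℝ x β) * inner ℝ (augment x) u ^ 2 ∂ν := by
  simp_rw [exp_mul_inner_sq_eq]
  rw [integral_finsetSum _ fun a _ => integrable_finsetSum _ fun b _ =>
    (integrable_exp_mul_augment henv a b).const_mul _]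
  simp_rw [dotProduct, Matrix.mulVec, dotProduct, Finset.mul_sum]
  refine Finset.sum_congr rfl fun a _ => ?_
  rw [integral_finsetSum _ fun b _ => (integrable_exp_mul_augment henv a b).const_mul _]
  refine Finset.sum_congr rfl fun b _ => ?_
  rw [integral_const_mul, sigmaStar_apply]
  ring

lemma posSemidef_sigmaStar (henv : Integrable (envelope β) ν) : (sigmaStar ν β).PosSemidef := by
  refine Matrix.PosSemidef.of_dotProduct_mulVec_nonneg ?_ fun u => ?_
  · ext a b
    simp only [Matrix.conjTranspose_apply, star_trivial, sigmaStar_apply]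
    congr 1; ext x; ring
  · have := dotProduct_sigmaStar henv (WithLp.toLp 2 u)
    simp only [star_trivial]
    rw [this]
    exact integral_nonneg fun x => by positivity

/-- The quadratic form is the mean of a nonnegative weight times a square, so the matrix is
semidefinite, and invertibility upgrades this to definiteness. -/
lemma posDef_sigmaStar (henv : Integrable (envelope β) ν) (hS : IsUnit (sigmaStar ν β)) :
    (sigmaStar ν β).PosDef :=
  (posSemidef_sigmaStar henv).posDef_iff_isUnit.2 hS

end Sigma

lemma inner_toEuclideanLin_self {d : ℕ} (S : Matrix (Fin d) (Fin d) ℝ)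
    (u : EuclideanSpace ℝ (Fin d)) :
    inner ℝ (Matrix.toEuclideanLin S u) u = u.ofLp ⬝ᵥ S.mulVec u.ofLp := by
  simp [PiLp.inner_apply, dotProduct, Matrix.toEuclideanLin]

/-- A positive definite matrix is coercive. -/
lemma exists_coercive_of_posDef {d : ℕ} {S : Matrix (Fin d) (Fin d) ℝ} (hS : S.PosDef) :
    ∃ lam > 0, ∀ u : EuclideanSpace ℝ (Fin d),
      lam * ‖u‖ ^ 2 ≤ inner ℝ (Matrix.toEuclideanLin S u) u := by
  have hcont : Continuous fun u : EuclideanSpace ℝ (Fin d) =>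
      (inner ℝ (Matrix.toEuclideanLin S u) u : ℝ) :=
    ((Matrix.toEuclideanLin S).continuous_of_finiteDimensional).inner continuous_id
  have hpos : ∀ u : EuclideanSpace ℝ (Fin d), u ≠ 0 →
      0 < (inner ℝ (Matrix.toEuclideanLin S u) u : ℝ) := by
    intro u hu
    rw [inner_toEuclideanLin_self]
    simpa using hS.dotProduct_mulVec_pos (x := u.ofLp) (by simpa using hu)
  -- Minimize over the unit sphere and extend by homogeneity; an empty sphere means that the space
  -- is trivial.
  rcases (Metric.sphere (0 : EuclideanSpace ℝ (Fin d)) 1).eq_empty_or_nonempty with he | hne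
  · refine ⟨1, one_pos, fun u => ?_⟩
    have : u = 0 := by
      by_contra hu
      have : ‖u‖⁻¹ • u ∈ Metric.sphere (0 : EuclideanSpace ℝ (Fin d)) 1 := by
        simp [norm_smul, hu]
      rw [he] at this
      exact this
    simp [this]
  · obtain ⟨v, hv, hmin⟩ := (isCompact_sphere (0 : EuclideanSpace ℝ (Fin d)) 1).exists_isMinOn
      hne hcont.continuousOn
    have hv0 : v ≠ 0 := by
      rintro rfl; simp at hv
    refine ⟨_, hpos v hv0, fun u => ?_⟩
    rcases eq_or_ne u 0 with rfl | hu
    · simp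
    have h1 := hmin (show ‖u‖⁻¹ • u ∈ Metric.sphere (0 : EuclideanSpace ℝ (Fin d)) 1 by
      simp [norm_smul, hu])
    simp only [Set.mem_ofPred_eq, map_smul, inner_smul_left, inner_smul_right, conj_trivial] at h1
    have hn : ‖u‖ ≠ 0 := norm_ne_zero_iff.2 hu
    calc _ ≤ ‖u‖⁻¹ * (‖u‖⁻¹ * inner ℝ (Matrix.toEuclideanLin S u) u) * ‖u‖ ^ 2 := by gcongr
      _ = _ := by field_simp

/-! ### The objectives as weighted log-likelihoods -/

/-- The weight of instance `i` in the objective of computer `k`. -/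
def ipwWeight {N K : ℕ} (y : Fin N → ℝ) (c : Fin N → Fin K) (k : Fin K) (i : Fin N) : ℝ :=
  y i + K * (1 - y i) * allocInd c i k

lemma ipwWeight_nonneg {N K : ℕ} {y : Fin N → ℝ} {i : Fin N} (hy : y i = 0 ∨ y i = 1)
    (c : Fin N → Fin K) (k : Fin K) : 0 ≤ ipwWeight y c k i := by
  unfold ipwWeight allocInd
  rcases hy with h | h <;> split_ifs <;> simp [h]

lemma sum_allocInd {N K : ℕ} (c : Fin N → Fin K) (i : Fin N) : ∑ k, allocInd c i k = 1 := by
  simp [allocInd]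

section Objectives

variable {p N K : ℕ} (x : Fin N → EuclideanSpace ℝ (Fin p)) (y : Fin N → ℝ)
  (c : Fin N → Fin K) (k : Fin K)

lemma ipwObjective_eq : ipwObjective x y c k
    = weightedLogLik (fun i => augment (x i)) y (ipwWeight y c k) := by
  ext θ
  unfold ipwObjective weightedLogLik ipwWeight
  refine Finset.sum_congr rfl fun i _ => ?_
  rw [responseProb_eq_logistic, log_logistic, log_one_sub_logistic]
  ring

lemma globalLogLik_eq : globalLogLik x y
    = weightedLogLik (fun i => augment (x i)) y (fun _ => 1) := by
  ext θ
  unfold globalLogLik weightedLogLik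
  refine Finset.sum_congr rfl fun i _ => ?_
  rw [responseProb_eq_logistic, log_logistic, log_one_sub_logistic]
  ring

lemma gradient_globalLogLik (θ : EuclideanSpace ℝ (Fin (p + 1))) :
    gradient (globalLogLik x y) θ
      = weightedScore (fun i => augment (x i)) y (fun _ => 1) θ := by
  rw [globalLogLik_eq]
  exact (hasGradientAt_weightedLogLik _ _ _ θ).gradient

/-- The local scores average to the global score. -/
lemma average_weightedScore_ipwWeight (hK : 0 < K) (θ : EuclideanSpace ℝ (Fin (p + 1))) :
    (K : ℝ)⁻¹ • ∑ k, weightedScore (fun i => augment (x i)) y (ipwWeight y c k) θ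
      = weightedScore (fun i => augment (x i)) y (fun _ => 1) θ := by
  unfold weightedScore
  rw [Finset.sum_comm, Finset.smul_sum]
  refine Finset.sum_congr rfl fun i _ => ?_
  rw [← Finset.sum_smul, smul_smul]
  congr 1
  have hK' : (K : ℝ) ≠ 0 := by positivity
  have : ∑ k, ipwWeight y c k i = K := by
    simp only [ipwWeight, Finset.sum_add_distrib, ← Finset.mul_sum, sum_allocInd]
    simp
    ring
  rw [Finset.sum_sub_distrib, ← Finset.sum_mul, this]
  simp
  field_simp

end Objectives

/-! ### Second moments of the local score and information -/

/-- An entry of the contribution of one instance to the negative Hessian. -/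
noncomputable def infoTerm {p : ℕ} (θ : EuclideanSpace ℝ (Fin (p + 1))) (a b : Fin (p + 1))
    (x : EuclideanSpace ℝ (Fin p)) : ℝ :=
  responseProb θ x * (1 - responseProb θ x) * (augment x a * augment x b)

lemma measurable_infoTerm {p : ℕ} (θ : EuclideanSpace ℝ (Fin (p + 1))) (a b : Fin (p + 1)) :
    Measurable (infoTerm θ a b) := by
  have := measurable_responseProb θ
  have ha := measurable_augment_apply a
  have hb := measurable_augment_apply b
  unfold infoTerm
  fun_prop

lemma abs_infoTerm_le {p : ℕ} (α : ℝ) (β : EuclideanSpace ℝ (Fin p)) (a b : Fin (p + 1))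
    (x : EuclideanSpace ℝ (Fin p)) :
    |infoTerm (paramOf α β) a b x| ≤ Real.exp α * envelope β x := by
  have h0 := responseProb_pos (paramOf α β) x
  have h1 := responseProb_lt_one (paramOf α β) x
  have h2 := responseProb_paramOf_le α β x
  unfold infoTerm
  rw [abs_mul, abs_mul, abs_mul, abs_of_pos h0, abs_of_pos (sub_pos.2 h1)]
  calc _ ≤ Real.exp α * Real.exp (inner ℝ x β) * 1 * (‖augment x‖ * ‖augment x‖) := by
        gcongr
        · linarith
        · exact abs_augment_le x a
        · exact abs_augment_le x b
    _ = Real.exp α * (Real.exp (inner ℝ x β) * ‖augment x‖ ^ 2) := by ring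
    _ ≤ _ := by gcongr; exact exp_inner_mul_le_envelope β x (by norm_num)

namespace IsLogisticSample

section Definitions

variable {Ω : Type*} {p N K : ℕ} {ν : Measure (EuclideanSpace ℝ (Fin p))}
  {θ : EuclideanSpace ℝ (Fin (p + 1))}
  {X : Fin N → Ω → EuclideanSpace ℝ (Fin p)} {Y : Fin N → Ω → ℝ} {c : Fin N → Ω → Fin K}
  {α : ℝ} {β : EuclideanSpace ℝ (Fin p)}

/-- The scaled deviation of a local sum of `f` over the sample from its mean. -/
noncomputable def localDev (X : Fin N → Ω → EuclideanSpace ℝ (Fin p)) (Y : Fin N → Ω → ℝ)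
    (c : Fin N → Ω → Fin K) (ν : Measure (EuclideanSpace ℝ (Fin p))) (k : Fin K)
    (f : EuclideanSpace ℝ (Fin p) → ℝ) (s : ℝ) (ω : Ω) : ℝ :=
  (N * s)⁻¹ * ∑ i, localTerm X Y c k f f i ω - s⁻¹ * ∫ x, f x ∂ν

/-- The fluctuation of the local information matrix and of the local envelope average. -/
noncomputable def infoFluct (X : Fin N → Ω → EuclideanSpace ℝ (Fin p)) (Y : Fin N → Ω → ℝ)
    (c : Fin N → Ω → Fin K) (ν : Measure (EuclideanSpace ℝ (Fin p))) (α : ℝ)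
    (β : EuclideanSpace ℝ (Fin p)) (k : Fin K) (ω : Ω) : ℝ :=
  ∑ a, ∑ b, localDev X Y c ν k (infoTerm (paramOf α β) a b) (Real.exp α) ω ^ 2
    + localDev X Y c ν k (envelope β) 1 ω ^ 2

lemma infoFluct_nonneg (k : Fin K) (ω : Ω) : 0 ≤ infoFluct X Y c ν α β k ω := by
  unfold infoFluct; positivity

/-- The local score at the true parameter. -/
noncomputable def localScore (X : Fin N → Ω → EuclideanSpace ℝ (Fin p)) (Y : Fin N → Ω → ℝ)
    (c : Fin N → Ω → Fin K) (θ : EuclideanSpace ℝ (Fin (p + 1))) (k : Fin K) (ω : Ω) :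
    EuclideanSpace ℝ (Fin (p + 1)) :=
  weightedScore (fun i => augment (X i ω)) (fun i => Y i ω)
    (ipwWeight (fun i => Y i ω) (fun i => c i ω) k) θ

/-- In this form the positive and negative contributions are separated, so the moment bounds for
local sums apply. -/
lemma localScore_apply (k : Fin K) (ω : Ω) (a : Fin (p + 1)) :
    localScore X Y c θ k ω a = ∑ i, localTerm X Y c k
      (fun x => (1 - responseProb θ x) * augment x a) (fun x => -(responseProb θ x * augment x a))
      i ω := by
  unfold localScore weightedScore localTerm ipwWeight
  simp only [WithLp.ofLp_sum, WithLp.ofLp_smul, Finset.sum_apply, Pi.smul_apply, smul_eq_mul,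
    responseProb_eq_logistic]
  refine Finset.sum_congr rfl fun i _ => ?_
  ring

end Definitions

variable {Ω : Type*} [MeasurableSpace Ω] {P : Measure Ω} {p N K : ℕ}
  {ν : Measure (EuclideanSpace ℝ (Fin p))} {θ : EuclideanSpace ℝ (Fin (p + 1))}
  {X : Fin N → Ω → EuclideanSpace ℝ (Fin p)} {Y : Fin N → Ω → ℝ} {c : Fin N → Ω → Fin K}
  {α : ℝ} {β : EuclideanSpace ℝ (Fin p)}

lemma integrable_of_le_envelope [IsFiniteMeasure ν] (henv2 : Integrable (fun x => envelope β x ^ 2) ν)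
    {f : EuclideanSpace ℝ (Fin p) → ℝ} (hf : Measurable f) {s : ℝ}
    (hfs : ∀ x, |f x| ≤ s * envelope β x) : Integrable (fun x => f x ^ 2) ν := by
  refine (henv2.const_mul (s ^ 2)).mono' (by fun_prop) (ae_of_all _ fun x => ?_)
  rw [Real.norm_of_nonneg (sq_nonneg _), ← sq_abs, ← mul_pow]
  exact pow_le_pow_left₀ (abs_nonneg _) (hfs x) 2

lemma memLp_localDev [IsProbabilityMeasure P] [IsProbabilityMeasure ν]
    (h : IsLogisticSample P ν θ X Y c)
    (henv2 : Integrable (fun x => envelope β x ^ 2) ν) (k : Fin K)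
    {f : EuclideanSpace ℝ (Fin p) → ℝ} (hf : Measurable f) {s : ℝ}
    (hfs : ∀ x, |f x| ≤ s * envelope β x) : MemLp (localDev X Y c ν k f s) 2 P := by
  have hi := integrable_of_le_envelope henv2 hf hfs
  exact ((h.memLp_sum_localTerm k hf hf hi hi).const_mul _).sub (memLp_const _)

/-- Using the same `f` for positives and negatives makes the mean of a local term equal to `∫ f`.
Its second moment is at most `K s²` times that of the envelope, and the normalization by `N s`
cancels the scale `s`, so the rate is `K/N` even for information entries of size `e^α`. -/
lemma integral_localDev_sq_le [IsProbabilityMeasure P] [IsProbabilityMeasure ν]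
    (h : IsLogisticSample P ν θ X Y c) (hN : 0 < N) (hK : 0 < K)
    (henv2 : Integrable (fun x => envelope β x ^ 2) ν) (k : Fin K)
    {f : EuclideanSpace ℝ (Fin p) → ℝ} (hf : Measurable f) {s : ℝ} (hs : 0 < s)
    (hfs : ∀ x, |f x| ≤ s * envelope β x) :
    ∫ ω, localDev X Y c ν k f s ω ^ 2 ∂P ≤ K / N * ∫ x, envelope β x ^ 2 ∂ν := by
  have hi := integrable_of_le_envelope henv2 hf hfs
  have hN' : (N : ℝ) ≠ 0 := by positivity
  have hK1 : (1 : ℝ) ≤ K := by exact_mod_cast hK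
  have hmean : ∫ x, (responseProb θ x * f x + (1 - responseProb θ x) * f x) ∂ν = ∫ x, f x ∂ν := by
    congr 1; ext x; ring
  have h1 := h.integral_sq_sum_localTerm_le hK k hf hf hi hi
  rw [hmean] at h1
  have h2 : ∫ x, (responseProb θ x * f x ^ 2 + (1 - responseProb θ x) * (K * f x ^ 2)) ∂ν
      ≤ K * s ^ 2 * ∫ x, envelope β x ^ 2 ∂ν := by
    rw [← integral_const_mul]
    refine integral_mono_of_nonneg (ae_of_all _ fun x => ?_) (henv2.const_mul _)
      (ae_of_all _ fun x => ?_)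
    · have := responseProb_pos θ x
      have := sub_pos.2 (responseProb_lt_one θ x)
      simp only [Pi.zero_apply]
      positivity
    · have hp := responseProb_pos θ x
      have h3 : f x ^ 2 ≤ (s * envelope β x) ^ 2 := by
        rw [← sq_abs]; exact pow_le_pow_left₀ (abs_nonneg _) (hfs x) 2
      calc responseProb θ x * f x ^ 2 + (1 - responseProb θ x) * (K * f x ^ 2)
          ≤ responseProb θ x * (K * f x ^ 2) + (1 - responseProb θ x) * (K * f x ^ 2) := by
            gcongr
            exact le_mul_of_one_le_left (sq_nonneg _) hK1
        _ = K * f x ^ 2 := by ring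
        _ ≤ K * (s * envelope β x) ^ 2 := by gcongr
        _ = _ := by ring
  have e : ∀ ω, localDev X Y c ν k f s ω ^ 2 = ((N * s) ^ 2)⁻¹ *
      (∑ i, localTerm X Y c k f f i ω - N * ∫ x, f x ∂ν) ^ 2 := by
    intro ω
    unfold localDev
    field_simp
  simp_rw [e]
  rw [integral_const_mul]
  calc _ ≤ ((N * s) ^ 2)⁻¹ * (N * (K * s ^ 2 * ∫ x, envelope β x ^ 2 ∂ν)) := by
        gcongr; exact h1.trans (by gcongr)
    _ = _ := by field_simp

lemma integrable_infoFluct [IsProbabilityMeasure P] [IsProbabilityMeasure ν]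
    (h : IsLogisticSample P ν θ X Y c)
    (henv2 : Integrable (fun x => envelope β x ^ 2) ν) (k : Fin K) :
    Integrable (infoFluct X Y c ν α β k) P :=
  (integrable_finsetSum _ fun a _ => integrable_finsetSum _ fun b _ =>
    (h.memLp_localDev henv2 k (measurable_infoTerm _ a b)
      (abs_infoTerm_le α β a b)).integrable_sq).add
    (h.memLp_localDev henv2 k (measurable_envelope β) (s := 1)
      (fun x => by rw [one_mul, abs_of_pos (envelope_pos β x)])).integrable_sq

lemma integral_infoFluct_le [IsProbabilityMeasure P] [IsProbabilityMeasure ν]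
    (h : IsLogisticSample P ν θ X Y c) (hN : 0 < N) (hK : 0 < K)
    (henv2 : Integrable (fun x => envelope β x ^ 2) ν) (k : Fin K) :
    ∫ ω, infoFluct X Y c ν α β k ω ∂P
      ≤ (((p : ℝ) + 1) ^ 2 + 1) * (∫ x, envelope β x ^ 2 ∂ν) * (K / N) := by
  have h1 : ∀ a b, Integrable (fun ω =>
      localDev X Y c ν k (infoTerm (paramOf α β) a b) (Real.exp α) ω ^ 2) P := fun a b =>
    (h.memLp_localDev henv2 k (measurable_infoTerm _ a b)
      (abs_infoTerm_le α β a b)).integrable_sq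
  have hb1 : ∀ x, |envelope β x| ≤ 1 * envelope β x :=
    fun x => by rw [one_mul, abs_of_pos (envelope_pos β x)]
  have h2 := (h.memLp_localDev henv2 k (measurable_envelope β) hb1).integrable_sq
  unfold infoFluct
  rw [integral_add (integrable_finsetSum _ fun a _ => integrable_finsetSum _ fun b _ => h1 a b) h2,
    integral_finsetSum _ fun a _ => integrable_finsetSum _ fun b _ => h1 a b]
  simp_rw [integral_finsetSum _ fun b _ => h1 _ b]
  calc _ ≤ ∑ _a : Fin (p + 1), ∑ _b : Fin (p + 1), (K / N * ∫ x, envelope β x ^ 2 ∂ν)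
        + K / N * ∫ x, envelope β x ^ 2 ∂ν := by
        gcongr with a _ b _
        · exact h.integral_localDev_sq_le hN hK henv2 k (measurable_infoTerm _ a b)
            (Real.exp_pos α) (abs_infoTerm_le α β a b)
        · exact h.integral_localDev_sq_le hN hK henv2 k (measurable_envelope β) one_pos hb1
    _ = _ := by simp; ring

/-- With `π` the response probability, the score is centred because `π (1 - π) - (1 - π) π = 0`. Per
instance, positives contribute at most `π ‖Z‖²`, of order `e^α`, and negatives at most `K π² ‖Z‖²`,
of order `K e^{2α}`. Boundedness of `K e^α` makes the second no larger in order than the first. -/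
lemma localScore_bounds [IsProbabilityMeasure P] [IsProbabilityMeasure ν]
    (h : IsLogisticSample P ν (paramOf α β) X Y c) (hK : 0 < K)
    (henv : Integrable (envelope β) ν)
    (henv2 : Integrable (fun x => envelope β x ^ 2) ν) (k : Fin K) :
    Integrable (fun ω => ‖localScore X Y c (paramOf α β) k ω‖ ^ 2) P ∧
    ∫ ω, ‖localScore X Y c (paramOf α β) k ω‖ ^ 2 ∂P
      ≤ ((p : ℝ) + 1) * (N * Real.exp α) *
        (∫ x, envelope β x ∂ν + K * Real.exp α * ∫ x, envelope β x ^ 2 ∂ν) := by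
  set θ := paramOf α β
  have hmp := measurable_responseProb θ
  have hb : ∀ a x, responseProb θ x * |augment x a| ≤ Real.exp α * envelope β x := by
    intro a x
    calc responseProb θ x * |augment x a|
        ≤ Real.exp α * Real.exp (inner ℝ x β) * ‖augment x‖ ^ 1 := by
          rw [pow_one]
          gcongr
          · exact responseProb_paramOf_le α β x
          · exact abs_augment_le x a
      _ ≤ _ := by
          rw [mul_assoc]; gcongr; exact exp_inner_mul_le_envelope β x (by norm_num)
  have hb2 : ∀ a x, responseProb θ x * augment x a ^ 2 ≤ Real.exp α * envelope β x := by
    intro a x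
    calc responseProb θ x * augment x a ^ 2
        ≤ Real.exp α * Real.exp (inner ℝ x β) * ‖augment x‖ ^ 2 := by
          rw [← sq_abs]
          gcongr
          · exact responseProb_paramOf_le α β x
          · exact abs_augment_le x a
      _ ≤ _ := by
          rw [mul_assoc]; gcongr; exact exp_inner_mul_le_envelope β x (by norm_num)
  -- No exponential factor occurs here, so the envelope with `β = 0` suffices, and it lies below the
  -- one for `β`.
  have hsq : ∀ a, Integrable (fun x => augment x a ^ 2) ν := by
    intro a
    have hma := measurable_augment_apply a
    refine (integrable_of_le_envelope (β := 0) (s := 1) ?_ hma fun x => ?_)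
    · refine henv2.mono' ((measurable_envelope 0).pow_const 2).aestronglyMeasurable
        (ae_of_all _ fun x => ?_)
      rw [Real.norm_of_nonneg (sq_nonneg _)]
      have : envelope 0 x ≤ envelope β x := by
        unfold envelope; gcongr; simp
      exact pow_le_pow_left₀ (envelope_pos 0 x).le this 2
    · have := exp_inner_mul_le_envelope 0 x (j := 1) (by norm_num)
      simp only [inner_zero_right, Real.exp_zero, one_mul, pow_one] at this ⊢
      exact (abs_augment_le x a).trans this
  have hu : ∀ a, Measurable (fun x => (1 - responseProb θ x) * augment x a) := fun a => by
    have hma := measurable_augment_apply a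
    fun_prop
  have hv : ∀ a, Measurable (fun x => -(responseProb θ x * augment x a)) := fun a => by
    have hma := measurable_augment_apply a
    fun_prop
  have hui : ∀ a, Integrable (fun x => ((1 - responseProb θ x) * augment x a) ^ 2) ν := fun a => by
    refine (hsq a).mono' ((hu a).pow_const 2).aestronglyMeasurable (ae_of_all _ fun x => ?_)
    have h0 := responseProb_pos θ x
    have h1 := responseProb_lt_one θ x
    rw [Real.norm_of_nonneg (sq_nonneg _), mul_pow]
    exact mul_le_of_le_one_left (sq_nonneg _) (pow_le_one₀ (by linarith) (by linarith))
  have hvi : ∀ a, Integrable (fun x => (-(responseProb θ x * augment x a)) ^ 2) ν := fun a => by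
    refine integrable_of_le_envelope henv2 (hv a) (s := Real.exp α) fun x => ?_
    rw [abs_neg, abs_mul, abs_of_pos (responseProb_pos θ x)]
    exact hb a x
  have hint : ∀ a, Integrable (fun ω => localScore X Y c θ k ω a ^ 2) P := fun a => by
    simp_rw [localScore_apply]
    exact (h.memLp_sum_localTerm k (hu a) (hv a) (hui a) (hvi a)).integrable_sq
  have hbound : ∀ a, ∫ ω, localScore X Y c θ k ω a ^ 2 ∂P ≤ N * Real.exp α *
      (∫ x, envelope β x ∂ν + K * Real.exp α * ∫ x, envelope β x ^ 2 ∂ν) := fun a => by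
    have h1 := h.integral_sq_sum_localTerm_le hK k (hu a) (hv a) (hui a) (hvi a)
    have hz : ∫ x, (responseProb θ x * ((1 - responseProb θ x) * augment x a)
        + (1 - responseProb θ x) * -(responseProb θ x * augment x a)) ∂ν = 0 := by
      rw [← integral_zero (EuclideanSpace ℝ (Fin p)) ℝ (μ := ν)]
      congr 1; ext x; ring
    rw [hz] at h1
    simp only [mul_zero, sub_zero] at h1
    simp_rw [localScore_apply]
    refine h1.trans ?_
    rw [mul_assoc]
    refine mul_le_mul_of_nonneg_left ?_ N.cast_nonneg
    rw [mul_add, ← integral_const_mul, ← integral_const_mul, ← integral_const_mul,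
      ← integral_add (henv.const_mul _) ((henv2.const_mul _).const_mul _)]
    refine integral_mono_of_nonneg (ae_of_all _ fun x => ?_)
      ((henv.const_mul _).add ((henv2.const_mul _).const_mul _)) (ae_of_all _ fun x => ?_)
    · have := responseProb_pos θ x
      have := sub_pos.2 (responseProb_lt_one θ x)
      simp only [Pi.zero_apply]
      positivity
    · have h0 := responseProb_pos θ x
      have h1 := responseProb_lt_one θ x
      have h2 : (1 - responseProb θ x) ^ 2 ≤ 1 := pow_le_one₀ (by linarith) (by linarith)
      have h3 := pow_le_pow_left₀ (by positivity) (hb a x) 2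
      rw [mul_pow, sq_abs, mul_pow] at h3
      simp only [neg_sq, mul_pow]
      refine add_le_add ?_ ?_
      · refine le_trans ?_ (hb2 a x)
        gcongr
        exact mul_le_of_le_one_left (sq_nonneg _) h2
      · calc (1 - responseProb θ x) * (K * (responseProb θ x ^ 2 * augment x a ^ 2))
            ≤ 1 * (K * (responseProb θ x ^ 2 * augment x a ^ 2)) := by gcongr; linarith
          _ ≤ 1 * (K * (Real.exp α ^ 2 * envelope β x ^ 2)) := by gcongr
          _ = _ := by ring
  have e : (fun ω => ‖localScore X Y c θ k ω‖ ^ 2)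
      = fun ω => ∑ a, localScore X Y c θ k ω a ^ 2 := by
    ext ω; simp [EuclideanSpace.norm_sq_eq]
  rw [e]
  refine ⟨integrable_finsetSum _ fun a _ => hint a, ?_⟩
  rw [integral_finsetSum _ fun a _ => hint a]
  refine (Finset.sum_le_sum fun a _ => hbound a).trans_eq ?_
  simp
  ring

end IsLogisticSample

/-! ### Expansion of the local estimators -/

lemma norm_le_sum_abs {d : ℕ} (v : EuclideanSpace ℝ (Fin d)) : ‖v‖ ≤ ∑ a, |v a| := by
  have h : ‖v‖ ^ 2 ≤ (∑ a, |v a|) ^ 2 := by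
    rw [EuclideanSpace.norm_sq_eq]
    simp only [Real.norm_eq_abs]
    exact Finset.sum_sq_le_sq_sum_of_nonneg fun _ _ => abs_nonneg _
  exact abs_le_of_sq_le_sq' h (Finset.sum_nonneg fun _ _ => abs_nonneg _) |>.2

lemma toEuclideanLin_apply_eq_sum {d : ℕ} (S : Matrix (Fin d) (Fin d) ℝ)
    (u : EuclideanSpace ℝ (Fin d)) (a : Fin d) :
    Matrix.toEuclideanLin S u a = ∑ b, S a b * u b := by
  simp [Matrix.toEuclideanLin, Matrix.mulVec, dotProduct]

lemma toEuclideanLin_inv_apply {d : ℕ} {S : Matrix (Fin d) (Fin d) ℝ} (hS : IsUnit S)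
    (v : EuclideanSpace ℝ (Fin d)) :
    Matrix.toEuclideanLin S (Matrix.toEuclideanLin S⁻¹ v) = v := by
  have hdet := (Matrix.isUnit_iff_isUnit_det S).1 hS
  ext a
  simp [Matrix.toEuclideanLin, Matrix.mulVec_mulVec, Matrix.mul_nonsing_inv S hdet]

/-- The distance between the mean scaled information and its limit. -/
noncomputable def infoBias {p : ℕ} (ν : Measure (EuclideanSpace ℝ (Fin p))) (α : ℝ)
    (β : EuclideanSpace ℝ (Fin p)) : ℝ :=
  ∑ a, ∑ b, |(Real.exp α)⁻¹ * ∫ x, infoTerm (paramOf α β) a b x ∂ν - sigmaStar ν β a b|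

lemma infoBias_nonneg {p : ℕ} (ν : Measure (EuclideanSpace ℝ (Fin p))) (α : ℝ)
    (β : EuclideanSpace ℝ (Fin p)) : 0 ≤ infoBias ν α β := by
  unfold infoBias; positivity

lemma tendsto_infoBias {p : ℕ} {ν : Measure (EuclideanSpace ℝ (Fin p))}
    {β : EuclideanSpace ℝ (Fin p)} (henv : Integrable (envelope β) ν) {α : ℕ → ℝ}
    (hα : Tendsto α atTop atBot) : Tendsto (fun N => infoBias ν (α N) β) atTop (𝓝 0) := by
  have : (0 : ℝ) = ∑ _a : Fin (p + 1), ∑ _b : Fin (p + 1), (0 : ℝ) := by simp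
  rw [this]
  refine tendsto_finsetSum _ fun a _ => tendsto_finsetSum _ fun b _ => ?_
  have hma := measurable_augment_apply a
  have hmb := measurable_augment_apply b
  have h := tendsto_scaled_information (ν := ν) (β := β) hα
    (f := fun x => augment x a * augment x b) (by fun_prop) (integrable_exp_mul_augment henv a b)
  rw [← sigmaStar_apply] at h
  have h2 := (h.sub_const (sigmaStar ν β a b)).abs
  rw [sub_self, abs_zero] at h2
  exact h2

lemma sq_sum_sum_abs_le {d : ℕ} (m : Fin d → Fin d → ℝ) :
    (∑ a, ∑ b, |m a b|) ^ 2 ≤ (d : ℝ) ^ 2 * ∑ a, ∑ b, m a b ^ 2 := by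
  calc (∑ a, ∑ b, |m a b|) ^ 2 ≤ d * ∑ a, (∑ b, |m a b|) ^ 2 := by
        simpa using sq_sum_le_card_mul_sum_sq (s := Finset.univ) (f := fun a => ∑ b, |m a b|)
    _ ≤ d * ∑ a, (d * ∑ b, m a b ^ 2) := by
        gcongr with a _
        simpa using sq_sum_le_card_mul_sum_sq (s := Finset.univ) (f := fun b => |m a b|)
    _ = _ := by rw [← Finset.mul_sum]; ring

/-- The product of the information error `D + B` and the score size `γ / √r` is split by AM-GM with
weight `b`. Afterwards only separate second moments matter, and `b` may be chosen once for all
computers. -/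
lemma newton_remainder_bound {r lam b A B D F' n γ w : ℝ} (hr : 0 < r) (hlam : 0 < lam)
    (hb : 0 < b) (hn : 0 ≤ n) (hγ : 0 ≤ γ) (hA : 0 ≤ A) (hD : 0 ≤ D) (hB : 0 ≤ B)
    (hDF : D ^ 2 ≤ F') (hnγ : n ≤ 2 / (lam * r) * γ)
    (hw : lam * w ≤ √r * ((D + B) * n + (A + 1) * n ^ 2)) :
    w ≤ lam⁻¹ * (2 / lam + (A + 1) * (4 / lam ^ 2)) *
      (b⁻¹ * (F' + B ^ 2) + b * (γ ^ 2 / r) + γ ^ 2 / r / √r) := by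
  -- Normalize: `s = √r`, score `γ = s * G`, estimation error `n = m / s`, so that `G` and `m` are
  -- of order one.
  obtain ⟨s, hs, rfl⟩ : ∃ s : ℝ, 0 < s ∧ r = s ^ 2 :=
    ⟨√r, Real.sqrt_pos.2 hr, (Real.sq_sqrt hr.le).symm⟩
  rw [Real.sqrt_sq hs.le] at hw ⊢
  obtain ⟨G, rfl⟩ : ∃ G, γ = s * G := ⟨γ / s, by field_simp⟩
  have hG : 0 ≤ G := nonneg_of_mul_nonneg_right hγ hs
  obtain ⟨m, rfl⟩ : ∃ m, n = m / s := ⟨n * s, by field_simp⟩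
  have hm : 0 ≤ m := by
    have := mul_nonneg hn hs.le
    rwa [div_mul_cancel₀ _ hs.ne'] at this
  have hmG : m ≤ 2 / lam * G := by
    calc m = m / s * s := by field_simp
      _ ≤ 2 / (lam * s ^ 2) * (s * G) * s := by gcongr
      _ = _ := by field_simp
  have e1 : (s * G) ^ 2 / s ^ 2 = G ^ 2 := by field_simp
  rw [e1]
  have h1 : (D + B) * G ≤ b⁻¹ * (F' + B ^ 2) + b * G ^ 2 := by
    have e1 : 0 ≤ b⁻¹ * ((D + B) - b * G) ^ 2 := by positivity
    have e2 : b⁻¹ * ((D + B) - b * G) ^ 2 = b⁻¹ * (D + B) ^ 2 - 2 * ((D + B) * G) + b * G ^ 2 := by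
      field_simp; ring
    have e3 : b⁻¹ * (D + B) ^ 2 ≤ b⁻¹ * (2 * (F' + B ^ 2)) := by
      gcongr
      nlinarith [sq_nonneg (D - B)]
    have e4 : 0 ≤ b * G ^ 2 := by positivity
    linarith
  have h2 : s * ((D + B) * (m / s) + (A + 1) * (m / s) ^ 2)
      = (D + B) * m + (A + 1) * (m ^ 2 / s) := by field_simp
  rw [h2] at hw
  have h3 : (D + B) * m ≤ 2 / lam * (b⁻¹ * (F' + B ^ 2) + b * G ^ 2) := by
    calc (D + B) * m ≤ (D + B) * (2 / lam * G) := by gcongr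
      _ = 2 / lam * ((D + B) * G) := by ring
      _ ≤ _ := by gcongr
  have h4 : (A + 1) * (m ^ 2 / s) ≤ (A + 1) * (4 / lam ^ 2) * (G ^ 2 / s) := by
    calc (A + 1) * (m ^ 2 / s) ≤ (A + 1) * ((2 / lam * G) ^ 2 / s) := by gcongr
      _ = _ := by ring
  have hF : 0 ≤ F' := (sq_nonneg D).trans hDF
  -- The target multiplies the sum of the constants by the sum of the error terms; `h6` and `h7` are
  -- the nonnegative cross terms this adds.
  have h5 : 0 ≤ b⁻¹ * (F' + B ^ 2) + b * G ^ 2 := by positivity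
  have h6 : 0 ≤ 2 / lam * (G ^ 2 / s) := by positivity
  have h7 := mul_nonneg (by positivity : 0 ≤ (A + 1) * (4 / lam ^ 2)) h5
  rw [mul_assoc, ← div_eq_inv_mul, le_div_iff₀ hlam, mul_comm]
  linarith

namespace IsLogisticSample

variable {Ω : Type*} {p N K : ℕ} {ν : Measure (EuclideanSpace ℝ (Fin p))}
  {X : Fin N → Ω → EuclideanSpace ℝ (Fin p)} {Y : Fin N → Ω → ℝ} {c : Fin N → Ω → Fin K}
  {α : ℝ} {β : EuclideanSpace ℝ (Fin p)}

lemma localTerm_self (k : Fin K) (f : EuclideanSpace ℝ (Fin p) → ℝ) (i : Fin N) (ω : Ω) :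
    localTerm X Y c k f f i ω
      = ipwWeight (fun i => Y i ω) (fun i => c i ω) k i * f (X i ω) := by
  unfold localTerm ipwWeight; ring

/-- Each entry of the scaled error splits into a fluctuation around its mean and the bias of that
mean; the sum of absolute entries bounds the operator norm. -/
lemma norm_weightedInfo_sub_le (hN : 0 < N) (k : Fin K) (ω : Ω)
    (u : EuclideanSpace ℝ (Fin (p + 1))) :
    ‖weightedInfo (fun i => augment (X i ω)) (ipwWeight (fun i => Y i ω) (fun i => c i ω) k)
        (paramOf α β) u - (N * Real.exp α) • Matrix.toEuclideanLin (sigmaStar ν β) u‖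
      ≤ (N * Real.exp α) * (∑ a, ∑ b, |localDev X Y c ν k (infoTerm (paramOf α β) a b)
        (Real.exp α) ω| + infoBias ν α β) * ‖u‖ := by
  have hr : (N : ℝ) * Real.exp α ≠ 0 := by positivity
  have hcoord : ∀ a, (weightedInfo (fun i => augment (X i ω))
        (ipwWeight (fun i => Y i ω) (fun i => c i ω) k) (paramOf α β) u
        - (N * Real.exp α) • Matrix.toEuclideanLin (sigmaStar ν β) u) a
      = (N * Real.exp α) * ∑ b, (localDev X Y c ν k (infoTerm (paramOf α β) a b) (Real.exp α) ω
        + ((Real.exp α)⁻¹ * ∫ x, infoTerm (paramOf α β) a b x ∂ν - sigmaStar ν β a b)) * u b := by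
    intro a
    have e : ∀ b, (N * Real.exp α) * ((localDev X Y c ν k (infoTerm (paramOf α β) a b)
        (Real.exp α) ω
        + ((Real.exp α)⁻¹ * ∫ x, infoTerm (paramOf α β) a b x ∂ν - sigmaStar ν β a b)) * u b)
        = ∑ i, ipwWeight (fun i => Y i ω) (fun i => c i ω) k i
            * infoTerm (paramOf α β) a b (X i ω) * u b
          - (N * Real.exp α) * (sigmaStar ν β a b * u b) := by
      intro b
      simp_rw [localDev, localTerm_self]
      rw [← Finset.sum_mul]
      field_simp
      ring
    rw [Finset.mul_sum]
    simp_rw [e]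
    rw [Finset.sum_sub_distrib, ← Finset.mul_sum, ← toEuclideanLin_apply_eq_sum, Finset.sum_comm]
    simp only [PiLp.sub_apply, PiLp.smul_apply, smul_eq_mul]
    congr 1
    simp only [weightedInfo, WithLp.ofLp_sum, WithLp.ofLp_smul, Finset.sum_apply, Pi.smul_apply,
      smul_eq_mul]
    refine Finset.sum_congr rfl fun i _ => ?_
    rw [inner_augment_eq (X i ω) u, Finset.mul_sum, Finset.sum_mul]
    refine Finset.sum_congr rfl fun b _ => ?_
    simp only [infoTerm, responseProb_eq_logistic]
    ring
  refine (norm_le_sum_abs _).trans ?_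
  simp_rw [hcoord]
  unfold infoBias
  rw [← Finset.sum_add_distrib, Finset.mul_sum, Finset.sum_mul]
  refine Finset.sum_le_sum fun a _ => ?_
  rw [abs_mul, abs_of_pos (by positivity : (0 : ℝ) < N * Real.exp α),
    mul_assoc (N * Real.exp α) _ ‖u‖, ← Finset.sum_add_distrib, Finset.sum_mul]
  refine mul_le_mul_of_nonneg_left ?_ (by positivity)
  refine (Finset.abs_sum_le_sum_abs _ _).trans (Finset.sum_le_sum fun b _ => ?_)
  rw [abs_mul]
  exact mul_le_mul (abs_add_le _ _) (PiLp.norm_apply_le u b) (abs_nonneg _) (by positivity)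

/-- At the truth the third-order term of an instance is at most `e^α` times the envelope, so the
Taylor constant is `r` times the weighted empirical mean of the envelope. -/
lemma norm_weightedScore_sub_le (hN : 0 < N) (k : Fin K) (ω : Ω)
    (hY : ∀ i, Y i ω = 0 ∨ Y i ω = 1) (u : EuclideanSpace ℝ (Fin (p + 1))) (hu : ‖u‖ ≤ 1) :
    ‖weightedScore (fun i => augment (X i ω)) (fun i => Y i ω)
        (ipwWeight (fun i => Y i ω) (fun i => c i ω) k) (paramOf α β + u)
      - localScore X Y c (paramOf α β) k ω
      + weightedInfo (fun i => augment (X i ω)) (ipwWeight (fun i => Y i ω) (fun i => c i ω) k)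
        (paramOf α β) u‖
      ≤ (N * Real.exp α) * (∫ x, envelope β x ∂ν + localDev X Y c ν k (envelope β) 1 ω)
        * ‖u‖ ^ 2 := by
  have hw : ∀ i, 0 ≤ ipwWeight (fun i => Y i ω) (fun i => c i ω) k i := fun i =>
    ipwWeight_nonneg (hY i) _ k
  refine (norm_weightedScore_taylor_le _ _ hw _ u hu).trans ?_
  gcongr
  have hN' : (N : ℝ) ≠ 0 := by positivity
  have e : (N * Real.exp α) * (∫ x, envelope β x ∂ν + localDev X Y c ν k (envelope β) 1 ω)
      = ∑ i, ipwWeight (fun i => Y i ω) (fun i => c i ω) k i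
          * (Real.exp α * envelope β (X i ω)) := by
    simp_rw [localDev, localTerm_self, mul_left_comm _ (Real.exp α)]
    rw [← Finset.mul_sum]
    field_simp
    ring
  rw [e]
  refine Finset.sum_le_sum fun i _ => mul_le_mul_of_nonneg_left ?_ (hw i)
  rw [inner_augment_paramOf, add_assoc, Real.exp_add, mul_assoc]
  exact mul_le_mul_of_nonneg_left (exp_inner_add_norm_mul_le_envelope β (X i ω)) (Real.exp_pos _).le

/-- On a favourable event, a local estimator is close to one Newton step from the truth. -/
theorem local_expansion (hN : 0 < N) (k : Fin K) (ω : Ω)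
    (hY : ∀ i, Y i ω = 0 ∨ Y i ω = 1) (hS : IsUnit (sigmaStar ν β)) {lam δ : ℝ} (hlam : 0 < lam)
    (hcoer : ∀ u, lam * ‖u‖ ^ 2 ≤ inner ℝ (Matrix.toEuclideanLin (sigmaStar ν β) u) u)
    (hδ0 : 0 < δ) (hδ1 : δ ≤ 1) (hδ : (∫ x, envelope β x ∂ν + 1) * δ ≤ lam / 4)
    (hbias : infoBias ν α β ≤ lam / 8)
    (hF1 : infoFluct X Y c ν α β k ω ≤ 1)
    (hF2 : ((p : ℝ) + 1) ^ 2 * infoFluct X Y c ν α β k ω ≤ (lam / 8) ^ 2)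
    (hg : ‖localScore X Y c (paramOf α β) k ω‖ < N * Real.exp α * δ * (lam / 2))
    {θhat : EuclideanSpace ℝ (Fin (p + 1))}
    (hmax : (∃ θ, IsMaxOn (ipwObjective (fun i => X i ω) (fun i => Y i ω) (fun i => c i ω) k)
      Set.univ θ) → IsMaxOn (ipwObjective (fun i => X i ω) (fun i => Y i ω) (fun i => c i ω) k)
      Set.univ θhat) {b : ℝ} (hb : 0 < b) :
    ‖√(N * Real.exp α) • (θhat - paramOf α β) - (√(N * Real.exp α))⁻¹ •
        Matrix.toEuclideanLin (sigmaStar ν β)⁻¹ (localScore X Y c (paramOf α β) k ω)‖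
      ≤ lam⁻¹ * (2 / lam + (∫ x, envelope β x ∂ν + 1) * (4 / lam ^ 2)) *
        (b⁻¹ * (((p : ℝ) + 1) ^ 2 * infoFluct X Y c ν α β k ω + infoBias ν α β ^ 2)
          + b * (‖localScore X Y c (paramOf α β) k ω‖ ^ 2 / (N * Real.exp α))
          + ‖localScore X Y c (paramOf α β) k ω‖ ^ 2 / (N * Real.exp α)
            / √(N * Real.exp α)) := by
  set r : ℝ := N * Real.exp α with hr
  have hr0 : 0 < r := by positivity
  set A := ∫ x, envelope β x ∂ν
  have hA : 0 ≤ A := integral_nonneg fun x => (envelope_pos β x).le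
  set F := infoFluct X Y c ν α β k ω with hF
  set B := infoBias ν α β
  set g := localScore X Y c (paramOf α β) k ω with hgdef
  set D := ∑ a, ∑ b, |localDev X Y c ν k (infoTerm (paramOf α β) a b) (Real.exp α) ω|
  set S := Matrix.toEuclideanLin (sigmaStar ν β)
  have hB : 0 ≤ B := infoBias_nonneg ν α β
  have hD0 : 0 ≤ D := by positivity
  have hD2 : D ^ 2 ≤ ((p : ℝ) + 1) ^ 2 * F := by
    refine (sq_sum_sum_abs_le _).trans ?_
    push_cast
    gcongr
    rw [hF, infoFluct]
    exact le_add_of_nonneg_right (sq_nonneg _)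
  have hD : D ≤ lam / 8 := abs_le_of_sq_le_sq' (hD2.trans hF2) (by positivity) |>.2
  have hT : localDev X Y c ν k (envelope β) 1 ω ≤ 1 := by
    have : localDev X Y c ν k (envelope β) 1 ω ^ 2 ≤ 1 ^ 2 := by
      rw [one_pow]
      refine le_trans ?_ hF1
      rw [hF, infoFluct]
      exact le_add_of_nonneg_left (by positivity)
    exact abs_le_of_sq_le_sq' this zero_le_one |>.2
  have hw : ∀ i, 0 ≤ ipwWeight (fun i => Y i ω) (fun i => c i ω) k i := fun i =>
    ipwWeight_nonneg (hY i) _ k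
  rw [ipwObjective_eq] at hmax
  -- Fluctuation and bias are each at most `lam / 8`, so `η = D + B ≤ lam / 4`; `T = A + 1` works
  -- since the envelope average exceeds its mean by at most one.
  obtain ⟨h1, h2⟩ := maximizer_expansion (S := S) (θ := paramOf α β) (r := r) (η := D + B)
    (T := A + 1) (lam := lam) (δ := δ) hr0 hlam hδ0 hδ1 (by positivity)
    (fun θ => hasGradientAt_weightedLogLik _ _ _ θ)
    (fun θ θ' => weightedLogLik_le_tangent _ _ hw θ θ')
    (H := weightedInfo (fun i => augment (X i ω))
      (ipwWeight (fun i => Y i ω) (fun i => c i ω) k) (paramOf α β))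
    (fun u hu => (norm_weightedScore_sub_le (ν := ν) hN k ω hY u hu).trans (by gcongr))
    (fun u => norm_weightedInfo_sub_le hN k ω u) hcoer (by linarith) hδ hg hmax
  change ‖θhat - paramOf α β‖ ≤ 2 / (lam * r) * ‖g‖ at h1
  change ‖S (θhat - paramOf α β) - r⁻¹ • g‖ ≤ _ at h2
  set u := θhat - paramOf α β
  set w := √r • u - (√r)⁻¹ • Matrix.toEuclideanLin (sigmaStar ν β)⁻¹ g with hwdef
  have hsr : 0 < √r := Real.sqrt_pos.2 hr0
  have hss : √r * √r = r := Real.mul_self_sqrt hr0.le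
  have hSw : S w = √r • (S u - r⁻¹ • g) := by
    rw [hwdef, map_sub, map_smul, map_smul, toEuclideanLin_inv_apply hS, smul_sub, smul_smul]
    have : √r * r⁻¹ = (√r)⁻¹ := by
      have h : r⁻¹ = (√r)⁻¹ * (√r)⁻¹ := by rw [← mul_inv, hss]
      rw [h]; field_simp
    rw [this]
  -- Coercivity turns the bound on `S w` into one on `w`, without a norm bound for the inverse
  -- matrix.
  have h3 : lam * ‖w‖ ≤ ‖S w‖ := by
    rcases (norm_nonneg w).eq_or_lt with h0 | h0
    · rw [← h0, mul_zero]; exact norm_nonneg _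
    · refine le_of_mul_le_mul_right ?_ h0
      calc lam * ‖w‖ * ‖w‖ = lam * ‖w‖ ^ 2 := by ring
        _ ≤ _ := (hcoer w).trans (real_inner_le_norm _ _)
  have h4 : lam * ‖w‖ ≤ √r * ((D + B) * ‖u‖ + (A + 1) * ‖u‖ ^ 2) := by
    refine h3.trans ?_
    rw [hSw, norm_smul, Real.norm_of_nonneg hsr.le]
    exact mul_le_mul_of_nonneg_left h2 hsr.le
  exact newton_remainder_bound hr0 hlam hb (norm_nonneg _) (norm_nonneg _) hA hD0 hB hD2 h1 h4

end IsLogisticSample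

/-! ### Averages of remainders -/

lemma measureReal_ge_le_integral_div {Ω : Type*} [MeasurableSpace Ω] {P : Measure Ω}
    [IsFiniteMeasure P] {f : Ω → ℝ} (hf0 : ∀ ω, 0 ≤ f ω) (hf : Integrable f P) {ε m : ℝ}
    (hε : 0 < ε) (hm : ∫ ω, f ω ∂P ≤ m) : P.real {ω | ε ≤ f ω} ≤ m / ε := by
  rw [le_div_iff₀ hε, mul_comm]
  exact (mul_meas_ge_le_integral_of_nonneg (ae_of_all _ hf0) hf ε).trans hm

/-- If a random vector is bounded by an average of remainders on the event that none of the
fluctuations `F`, `Q` is large, and the union bound over these events is negligible, then the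
vector tends to zero in probability. -/
theorem tendstoInMeasure_zero_of_average_bound {Ω E : Type*} [MeasurableSpace Ω] {P : Measure Ω}
    [IsProbabilityMeasure P] [NormedAddCommGroup E] {D : ℕ → Ω → E} {K : ℕ → ℕ}
    (hK : ∀ N, 0 < K N) {F Q : (N : ℕ) → Fin (K N) → Ω → ℝ}
    (hF0 : ∀ N k ω, 0 ≤ F N k ω) (hQ0 : ∀ N k ω, 0 ≤ Q N k ω)
    (hF : ∀ N k, Integrable (F N k) P) (hQ : ∀ N k, Integrable (Q N k) P)
    {C₁ C₂ d κ κ' : ℝ} {e r bias : ℕ → ℝ} (hC₁ : 0 ≤ C₁) (hC₂ : 0 ≤ C₂) (hd : 0 ≤ d)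
    (hκ : 0 < κ) (hκ' : 0 < κ')
    (he0 : ∀ᶠ N in atTop, 0 < e N) (hr0 : ∀ᶠ N in atTop, 0 < r N)
    (hFe : ∀ᶠ N in atTop, ∀ k, ∫ ω, F N k ω ∂P ≤ C₂ * e N)
    (hQC : ∀ᶠ N in atTop, ∀ k, ∫ ω, Q N k ω ∂P ≤ C₂)
    (hKe : Tendsto (fun N => K N * e N) atTop (𝓝 0))
    (hKr : Tendsto (fun N => K N / r N) atTop (𝓝 0))
    (hbias : Tendsto bias atTop (𝓝 0))
    (hD : ∀ᶠ N in atTop, ∀ᵐ ω ∂P, (∀ k, F N k ω < κ ∧ Q N k ω < κ' * r N) → ∀ b > 0,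
      ‖D N ω‖ ≤ (K N : ℝ)⁻¹ * ∑ k, C₁ * (b⁻¹ * (d * F N k ω + bias N ^ 2) + b * Q N k ω
        + Q N k ω / √(r N))) :
    TendstoInMeasure P D atTop (fun _ => 0) := by
  rw [tendstoInMeasure_iff_measureReal_norm]
  intro ε hε
  simp only [sub_zero]
  have hK1 : ∀ N, (1 : ℝ) ≤ K N := fun N => by exact_mod_cast hK N
  have he : Tendsto e atTop (𝓝 0) := by
    refine squeeze_zero' (he0.mono fun N h => h.le) (he0.mono fun N h => ?_) hKe
    exact le_mul_of_one_le_left h.le (hK1 N)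
  have hr : Tendsto (fun N => (r N)⁻¹) atTop (𝓝 0) := by
    refine squeeze_zero' (hr0.mono fun N h => (inv_pos.2 h).le) (hr0.mono fun N h => ?_) hKr
    rw [div_eq_mul_inv]
    exact le_mul_of_one_le_left (inv_pos.2 h).le (hK1 N)
  have hsr : Tendsto (fun N => (√(r N))⁻¹) atTop (𝓝 0) := by
    have := (Real.continuous_sqrt.tendsto 0).comp hr
    simpa [Function.comp_def, Real.sqrt_inv] using this
  -- This choice makes `b⁻¹ (e + bias²)` equal to `b`, so both AM-GM terms vanish; `e > 0` keeps `b`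
  -- positive.
  set b : ℕ → ℝ := fun N => √(e N + bias N ^ 2) with hb
  have hb0 : Tendsto b atTop (𝓝 0) := by
    have : Tendsto (fun N => e N + bias N ^ 2) atTop (𝓝 0) := by
      simpa using he.add (hbias.pow 2)
    have h := (Real.continuous_sqrt.tendsto 0).comp this
    rw [Real.sqrt_zero] at h
    exact h
  have hlim : Tendsto (fun N => C₂ * (K N * e N) / κ + C₂ * (K N / r N) / κ'
      + C₁ * ((d * C₂ + 1) * b N + b N * C₂ + C₂ * (√(r N))⁻¹) / ε) atTop (𝓝 0) := by
    have h := (((hKe.const_mul C₂).div_const κ).add ((hKr.const_mul C₂).div_const κ')).add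
      (((((hb0.const_mul (d * C₂ + 1)).add (hb0.mul_const C₂)).add
        (hsr.const_mul C₂)).const_mul C₁).div_const ε)
    simpa using h
  refine squeeze_zero' (Eventually.of_forall fun _ => measureReal_nonneg) ?_ hlim
  filter_upwards [he0, hr0, hFe, hQC, hD] with N he0 hr0 hFe hQC hD
  have hbp : 0 < b N := Real.sqrt_pos.2 (by positivity)
  have hKp : (0 : ℝ) < K N := by exact_mod_cast hK N
  set W : Ω → ℝ := fun ω => (K N : ℝ)⁻¹ * ∑ k, C₁ * ((b N)⁻¹ * (d * F N k ω + bias N ^ 2)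
    + b N * Q N k ω + Q N k ω / √(r N)) with hW
  have hWi : ∀ k, Integrable (fun ω => C₁ * ((b N)⁻¹ * (d * F N k ω + bias N ^ 2)
      + b N * Q N k ω + Q N k ω / √(r N))) P := fun k =>
    ((((((hF N k).const_mul d).add (integrable_const _)).const_mul _).add
      ((hQ N k).const_mul _)).add ((hQ N k).div_const _)).const_mul _
  have hWint : Integrable W P := (integrable_finsetSum _ fun k _ => hWi k).const_mul _
  have hW0 : ∀ ω, 0 ≤ W ω := fun ω => by
    have h1 := hF0 N
    have h2 := hQ0 N
    refine mul_nonneg (by positivity) (Finset.sum_nonneg fun k _ => mul_nonneg hC₁ ?_)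
    have := h1 k ω
    have := h2 k ω
    positivity
  have hWm : ∫ ω, W ω ∂P ≤ C₁ * ((d * C₂ + 1) * b N + b N * C₂ + C₂ * (√(r N))⁻¹) := by
    have hk : ∀ k, ∫ ω, C₁ * ((b N)⁻¹ * (d * F N k ω + bias N ^ 2)
        + b N * Q N k ω + Q N k ω / √(r N)) ∂P
        ≤ C₁ * ((d * C₂ + 1) * b N + b N * C₂ + C₂ * (√(r N))⁻¹) := by
      intro k
      have i1 := ((hF N k).const_mul d)
      have i2 := (i1.add (integrable_const (bias N ^ 2))).const_mul (b N)⁻¹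
      have i3 := (hQ N k).const_mul (b N)
      have i4 := (hQ N k).div_const (√(r N))
      simp only [Pi.add_apply] at i2
      rw [integral_const_mul, integral_add (by exact i2.add i3) i4, integral_add i2 i3,
        integral_const_mul, integral_add i1 (integrable_const _), integral_const_mul,
        integral_const_mul, integral_div]
      simp only [integral_const, probReal_univ, smul_eq_mul, one_mul]
      refine mul_le_mul_of_nonneg_left (add_le_add (add_le_add ?_ ?_) ?_) hC₁
      · have hbb : b N * b N = e N + bias N ^ 2 := Real.mul_self_sqrt (by positivity)
        rw [inv_mul_le_iff₀ hbp]
        calc d * ∫ ω, F N k ω ∂P + bias N ^ 2 ≤ d * (C₂ * e N) + bias N ^ 2 := by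
              gcongr; exact hFe k
          _ ≤ (d * C₂ + 1) * (e N + bias N ^ 2) := by
              have : 0 ≤ d * C₂ * bias N ^ 2 := by positivity
              nlinarith
          _ = _ := by rw [← hbb]; ring
      · gcongr; exact hQC k
      · rw [← div_eq_mul_inv]; gcongr; exact hQC k
    rw [hW, integral_const_mul, integral_finsetSum _ fun k _ => hWi k, inv_mul_le_iff₀ hKp]
    refine (Finset.sum_le_sum fun k _ => hk k).trans_eq ?_
    simp
  -- The vector exceeds `ε` only if the averaged remainder `W` does or some computer is bad.
  -- Markov's inequality bounds each event, and the union over `k` contributes the factor `K`.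
  have hsub : P.real {ω | ε ≤ ‖D N ω‖} ≤ P.real ((⋃ k, {ω | κ ≤ F N k ω})
      ∪ (⋃ k, {ω | κ' * r N ≤ Q N k ω}) ∪ {ω | ε ≤ W ω}) := by
    refine ENNReal.toReal_mono (measure_ne_top _ _) (measure_mono_ae ?_)
    filter_upwards [hD] with ω hω hle
    by_cases h : ∀ k, F N k ω < κ ∧ Q N k ω < κ' * r N
    · right
      exact le_trans hle (hω h _ hbp)
    · left
      push Not at h
      obtain ⟨k, hk⟩ := h
      rcases lt_or_ge (F N k ω) κ with h1 | h1
      · exact Or.inr (Set.mem_iUnion.2 ⟨k, hk h1⟩)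
      · exact Or.inl (Set.mem_iUnion.2 ⟨k, h1⟩)
  refine hsub.trans ((measureReal_union_le _ _).trans (add_le_add
    ((measureReal_union_le _ _).trans (add_le_add ?_ ?_)) ?_))
  · refine (measureReal_iUnion_fintype_le _).trans ?_
    refine (Finset.sum_le_sum fun k _ =>
      measureReal_ge_le_integral_div (hF0 N k) (hF N k) hκ (hFe k)).trans_eq ?_
    simp; ring
  · refine (measureReal_iUnion_fintype_le _).trans ?_
    refine (Finset.sum_le_sum fun k _ =>
      measureReal_ge_le_integral_div (hQ0 N k) (hQ N k) (mul_pos hκ' hr0) (hQC k)).trans_eq ?_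
    simp; field_simp
  · exact measureReal_ge_le_integral_div hW0 hWint hε hWm

/-! ### The asymptotic linear representation -/

section Rates

variable {α : ℕ → ℝ} {K : ℕ → ℕ}

lemma tendsto_mul_exp_atTop (hαN : Tendsto (fun N : ℕ => α N + Real.log N) atTop atTop) :
    Tendsto (fun N : ℕ => N * Real.exp (α N)) atTop atTop := by
  refine (Real.tendsto_exp_atTop.comp hαN).congr' ?_
  filter_upwards [eventually_gt_atTop 0] with N hN
  have : (0 : ℝ) < N := by exact_mod_cast hN
  simp only [Function.comp_apply]
  rw [Real.exp_add, Real.exp_log this, mul_comm]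

/-- The ratio `log² N · K / (N e^α)` is bounded and `log² N` diverges. -/
lemma tendsto_div_mul_exp (hC3 : (fun N : ℕ => Real.log N ^ 2 / ((N : ℝ) / K N * Real.exp (α N)))
      =O[atTop] (fun _ => (1 : ℝ))) :
    Tendsto (fun N : ℕ => K N / (N * Real.exp (α N))) atTop (𝓝 0) := by
  obtain ⟨C, hC⟩ := hC3.bound
  have hlog : Tendsto (fun N : ℕ => Real.log N ^ 2) atTop atTop :=
    (tendsto_pow_atTop two_ne_zero).comp (Real.tendsto_log_atTop.comp tendsto_natCast_atTop_atTop)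
  refine squeeze_zero' (Eventually.of_forall fun N => by positivity) ?_
    (hlog.const_div_atTop C)
  filter_upwards [hC, hlog.eventually_gt_atTop 0] with N hN hlog
  rw [le_div_iff₀ hlog]
  rw [norm_one, mul_one] at hN
  refine le_of_eq_of_le ?_ ((le_abs_self _).trans hN)
  rw [div_mul_eq_mul_div, div_mul_eq_mul_div, div_div_eq_mul_div, mul_comm]

/-- `K² / N` is the product of `K / (N e^α) → 0` and the bounded `K e^α`. -/
lemma tendsto_sq_div (hC3 : (fun N : ℕ => Real.log N ^ 2 / ((N : ℝ) / K N * Real.exp (α N)))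
      =O[atTop] (fun _ => (1 : ℝ)))
    (hratio : (fun N : ℕ => (K N : ℝ) * Real.exp (α N)) =O[atTop] (fun _ => (1 : ℝ))) :
    Tendsto (fun N : ℕ => (K N : ℝ) * (K N / N)) atTop (𝓝 0) := by
  have h := (tendsto_div_mul_exp hC3).zero_mul_isBoundedUnder_le
    ((isBigO_one_iff ℝ).1 hratio)
  refine h.congr fun N => ?_
  have := (Real.exp_pos (α N)).ne'
  rcases eq_or_ne (N : ℝ) 0 with h0 | h0
  · simp [h0]
  · field_simp

end Rates

/-- The asymptotic linear representation of the one-shot average of the local estimators. -/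
theorem ipw_linear_representation {Ω : Type*} [MeasurableSpace Ω] (P : Measure Ω)
    [IsProbabilityMeasure P]
    {p : ℕ} (ν : Measure (EuclideanSpace ℝ (Fin p))) [IsProbabilityMeasure ν]
    (α : ℕ → ℝ) (β : EuclideanSpace ℝ (Fin p)) (K : ℕ → ℕ) (hK : ∀ N, 0 < K N)
    (X : (N : ℕ) → Fin N → Ω → EuclideanSpace ℝ (Fin p)) (Y : (N : ℕ) → Fin N → Ω → ℝ)
    (c : (N : ℕ) → Fin N → Ω → Fin (K N))
    (hsample : ∀ N, IsLogisticSample P ν (paramOf (α N) β) (X N) (Y N) (c N))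
    (henv : Integrable (envelope β) ν) (henv2 : Integrable (fun x => envelope β x ^ 2) ν)
    (hC3 : (fun N : ℕ => Real.log N ^ 2 / ((N : ℝ) / K N * Real.exp (α N))) =O[atTop]
      (fun _ => (1 : ℝ)))
    (hα : Tendsto α atTop atBot)
    (hratio : (fun N : ℕ => (K N : ℝ) * Real.exp (α N)) =O[atTop] (fun _ => (1 : ℝ)))
    (hS : IsUnit (sigmaStar ν β))
    (θloc : (N : ℕ) → Fin (K N) → Ω → EuclideanSpace ℝ (Fin (p + 1)))
    (hθloc : ∀ N k, IsArgmaxEstimator P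
      (fun ω => ipwObjective (fun i => X N i ω) (fun i => Y N i ω) (fun i => c N i ω) k)
      (θloc N k)) :
    TendstoInMeasure P
      (fun (N : ℕ) ω =>
        √(N * Real.exp (α N)) • (oneShot (fun k => θloc N k ω) - paramOf (α N) β)
          - (√(N * Real.exp (α N)))⁻¹ • Matrix.toEuclideanLin (sigmaStar ν β)⁻¹
              (gradient (globalLogLik (fun i => X N i ω) (fun i => Y N i ω)) (paramOf (α N) β)))
      atTop (fun _ => 0) := by
  obtain ⟨lam, hlam, hcoer⟩ := exists_coercive_of_posDef (posDef_sigmaStar henv hS)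
  obtain ⟨C, hC⟩ := hratio.bound
  set A := ∫ x, envelope β x ∂ν
  set A₂ := ∫ x, envelope β x ^ 2 ∂ν
  have hA : 0 ≤ A := integral_nonneg fun x => (envelope_pos β x).le
  have hA₂ : 0 ≤ A₂ := integral_nonneg fun x => sq_nonneg _
  set δ : ℝ := min 1 (lam / 4 / (A + 1))
  have hδ0 : 0 < δ := lt_min one_pos (by positivity)
  have hδ1 : δ ≤ 1 := min_le_left _ _
  have hδ : (A + 1) * δ ≤ lam / 4 := by
    rw [mul_comm, ← le_div_iff₀ (by positivity)]; exact min_le_right _ _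
  have hbias := tendsto_infoBias henv hα
  set d : ℝ := ((p : ℝ) + 1) ^ 2
  have hd : 0 < d := by positivity
  -- The threshold `κ` encodes both smallness conditions on the fluctuation, and `κ'` is such that
  -- `Q < κ' r` means `‖g‖ < r δ lam / 2`. `C₂` adds the constants of the two moment bounds; `|C|`
  -- ensures that it is nonnegative.
  refine tendstoInMeasure_zero_of_average_bound hK
    (F := fun N k => IsLogisticSample.infoFluct (X N) (Y N) (c N) ν (α N) β k)
    (Q := fun N k ω => ‖IsLogisticSample.localScore (X N) (Y N) (c N) (paramOf (α N) β) k ω‖ ^ 2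
      / (N * Real.exp (α N)))
    (C₁ := lam⁻¹ * (2 / lam + (A + 1) * (4 / lam ^ 2)))
    (C₂ := (d + 1) * A₂ + ((p : ℝ) + 1) * (A + |C| * A₂)) (d := d)
    (κ := min 1 ((lam / 8) ^ 2 / d)) (κ' := (δ * (lam / 2)) ^ 2)
    (e := fun N => K N / N) (r := fun N => N * Real.exp (α N))
    (bias := fun N => infoBias ν (α N) β)
    (fun N k ω => IsLogisticSample.infoFluct_nonneg k ω) (fun N k ω => by positivity)
    (fun N k => (hsample N).integrable_infoFluct henv2 k)
    (fun N k => ((hsample N).localScore_bounds (hK N) henv henv2 k).1.div_const _)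
    (by positivity) (by positivity) hd.le (lt_min one_pos (by positivity)) (by positivity)
    ?_ ?_ ?_ ?_ (tendsto_sq_div hC3 hratio) (tendsto_div_mul_exp hC3) hbias ?_
  · filter_upwards [eventually_gt_atTop 0] with N hN
    have := hK N
    positivity
  · filter_upwards [eventually_gt_atTop 0] with N hN
    positivity
  · filter_upwards [eventually_gt_atTop 0] with N hN k
    refine ((hsample N).integral_infoFluct_le hN (hK N) henv2 k).trans ?_
    gcongr
    exact le_add_of_nonneg_right (by positivity)
  · filter_upwards [eventually_gt_atTop 0, hC] with N hN hC k
    have hr : (0 : ℝ) < N * Real.exp (α N) := by positivity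
    rw [integral_div, div_le_iff₀ hr]
    refine ((hsample N).localScore_bounds (hK N) henv henv2 k).2.trans ?_
    have hKC : K N * Real.exp (α N) ≤ |C| := by
      have h1 : (K N : ℝ) * Real.exp (α N) ≤ C := (le_abs_self _).trans (by simpa using hC)
      exact h1.trans (le_abs_self C)
    calc _ = ((p : ℝ) + 1) * (A + K N * Real.exp (α N) * A₂) * (N * Real.exp (α N)) := by ring
      _ ≤ ((p : ℝ) + 1) * (A + |C| * A₂) * (N * Real.exp (α N)) := by gcongr
      _ ≤ _ := by
        gcongr
        exact le_add_of_nonneg_left (by positivity)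
  · filter_upwards [eventually_gt_atTop 0,
      hbias.eventually_le_const (show 0 < lam / 8 by positivity)] with N hN hbias
    have hY : ∀ᵐ ω ∂P, ∀ i, Y N i ω = 0 ∨ Y N i ω = 1 :=
      ae_all_iff.2 fun i => (hsample N).binary_Y i
    have hmax := ae_all_iff.2 fun k => (hθloc N k).2
    filter_upwards [hY, hmax] with ω hY hmax hgood b hb
    have hr : (0 : ℝ) < N * Real.exp (α N) := by positivity
    have hKp : (0 : ℝ) < K N := by exact_mod_cast hK N
    have e : √(N * Real.exp (α N)) • (oneShot (fun k => θloc N k ω) - paramOf (α N) β)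
          - (√(N * Real.exp (α N)))⁻¹ • Matrix.toEuclideanLin (sigmaStar ν β)⁻¹
              (gradient (globalLogLik (fun i => X N i ω) (fun i => Y N i ω)) (paramOf (α N) β))
        = (K N : ℝ)⁻¹ • ∑ k, (√(N * Real.exp (α N)) • (θloc N k ω - paramOf (α N) β)
          - (√(N * Real.exp (α N)))⁻¹ • Matrix.toEuclideanLin (sigmaStar ν β)⁻¹
            (IsLogisticSample.localScore (X N) (Y N) (c N) (paramOf (α N) β) k ω)) := by
      rw [gradient_globalLogLik, ← average_weightedScore_ipwWeight _ _ (fun i => c N i ω) (hK N),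
        Finset.sum_sub_distrib, ← Finset.smul_sum, ← Finset.smul_sum, smul_sub (K N : ℝ)⁻¹,
        map_smul, map_sum, Finset.sum_sub_distrib, oneShot]
      congr 1
      · rw [smul_comm (K N : ℝ)⁻¹]
        congr 1
        rw [smul_sub]
        congr 1
        simp only [Finset.sum_const, Finset.card_univ, Fintype.card_fin]
        rw [← Nat.cast_smul_eq_nsmul ℝ, smul_smul, inv_mul_cancel₀ hKp.ne', one_smul]
      · rw [smul_comm]
        rfl
    rw [e, norm_smul, Real.norm_of_nonneg (inv_nonneg.2 hKp.le)]
    refine mul_le_mul_of_nonneg_left ((norm_sum_le _ _).trans (Finset.sum_le_sum fun k _ => ?_))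
      (inv_nonneg.2 hKp.le)
    obtain ⟨hF, hQ⟩ := hgood k
    refine IsLogisticSample.local_expansion hN k ω hY hS hlam hcoer hδ0 hδ1 hδ hbias
      (hF.le.trans (min_le_left _ _)) ?_ ?_ (hmax k) hb
    · rw [mul_comm, ← le_div_iff₀ hd]
      exact hF.le.trans (min_le_right _ _)
    · rw [div_lt_iff₀ hr] at hQ
      refine lt_of_pow_lt_pow_left₀ 2 (by positivity) (hQ.trans_eq ?_)
      ring

/-! ### The global maximum likelihood estimator -/

/-- With a single computer the inverse-probability weight is one and the local objective is the
global likelihood, so the global estimator needs no separate analysis. -/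
lemma IsLogisticSample.single {Ω : Type*} [MeasurableSpace Ω] {P : Measure Ω}
    [IsProbabilityMeasure P] {p N K : ℕ}
    {ν : Measure (EuclideanSpace ℝ (Fin p))} {θ : EuclideanSpace ℝ (Fin (p + 1))}
    {X : Fin N → Ω → EuclideanSpace ℝ (Fin p)} {Y : Fin N → Ω → ℝ} {c : Fin N → Ω → Fin K}
    (h : IsLogisticSample P ν θ X Y c) :
    IsLogisticSample P ν θ X Y (fun _ _ => (0 : Fin 1)) where
  measurable_X := h.measurable_X
  measurable_Y := h.measurable_Y
  measurable_c _ := measurable_const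
  indep := h.indep.comp (fun _ q => (q.1, (0 : Fin 1))) fun _ =>
    measurable_fst.prodMk measurable_const
  law_X := h.law_X
  binary_Y := h.binary_Y
  cond_Y := h.cond_Y
  indep_c _ := indepFun_const_right _ _
  uniform_c i k := by simp [Subsingleton.elim (0 : Fin 1) k]

lemma ipwObjective_single {p N : ℕ} (x : Fin N → EuclideanSpace ℝ (Fin p)) (y : Fin N → ℝ)
    (k : Fin 1) : ipwObjective x y (fun _ => (0 : Fin 1)) k = globalLogLik x y := by
  rw [ipwObjective_eq, globalLogLik_eq]
  congr 1
  ext i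
  simp [ipwWeight, allocInd, Subsingleton.elim (0 : Fin 1) k]

/-- The asymptotic linear representation of the global maximum likelihood estimator. -/
theorem gmle_linear_representation {Ω : Type*} [MeasurableSpace Ω] (P : Measure Ω)
    [IsProbabilityMeasure P]
    {p : ℕ} (ν : Measure (EuclideanSpace ℝ (Fin p))) [IsProbabilityMeasure ν]
    (α : ℕ → ℝ) (β : EuclideanSpace ℝ (Fin p)) (K : ℕ → ℕ) (hK : ∀ N, 0 < K N)
    (X : (N : ℕ) → Fin N → Ω → EuclideanSpace ℝ (Fin p)) (Y : (N : ℕ) → Fin N → Ω → ℝ)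
    (c : (N : ℕ) → Fin N → Ω → Fin (K N))
    (hsample : ∀ N, IsLogisticSample P ν (paramOf (α N) β) (X N) (Y N) (c N))
    (henv : Integrable (envelope β) ν) (henv2 : Integrable (fun x => envelope β x ^ 2) ν)
    (hC3 : (fun N : ℕ => Real.log N ^ 2 / ((N : ℝ) / K N * Real.exp (α N))) =O[atTop]
      (fun _ => (1 : ℝ)))
    (hα : Tendsto α atTop atBot)
    (hratio : (fun N : ℕ => (K N : ℝ) * Real.exp (α N)) =O[atTop] (fun _ => (1 : ℝ)))
    (hS : IsUnit (sigmaStar ν β))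
    (θgmle : ℕ → Ω → EuclideanSpace ℝ (Fin (p + 1)))
    (hθgmle : ∀ N, IsArgmaxEstimator P
      (fun ω => globalLogLik (fun i => X N i ω) (fun i => Y N i ω)) (θgmle N)) :
    TendstoInMeasure P
      (fun (N : ℕ) ω =>
        √(N * Real.exp (α N)) • (θgmle N ω - paramOf (α N) β)
          - (√(N * Real.exp (α N)))⁻¹ • Matrix.toEuclideanLin (sigmaStar ν β)⁻¹
              (gradient (globalLogLik (fun i => X N i ω) (fun i => Y N i ω)) (paramOf (α N) β)))
      atTop (fun _ => 0) := by
  have hK1 : ∀ N, (1 : ℝ) ≤ K N := fun N => by exact_mod_cast hK N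
  have h := ipw_linear_representation P ν α β (fun _ => 1) (fun _ => one_pos) X Y
    (fun _ _ _ => (0 : Fin 1)) (fun N => (hsample N).single) henv henv2 ?_ hα ?_ hS
    (fun N _ => θgmle N) (fun N k => by simpa only [ipwObjective_single] using hθgmle N)
  · simpa [oneShot] using h
  -- Since `K ≥ 1`, the rate conditions for one computer follow from those for `K`.
  · refine (IsBigO.of_norm_le fun N => ?_).trans hC3
    have := hK1 N
    rw [Real.norm_of_nonneg (by positivity), Nat.cast_one,
      div_one]
    rcases Nat.eq_zero_or_pos N with rfl | hN
    · simp
    gcongr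
    exact div_le_self N.cast_nonneg this
  · refine (IsBigO.of_norm_le fun N => ?_).trans hratio
    rw [Real.norm_of_nonneg (by positivity), Nat.cast_one]
    gcongr
    exact hK1 N

/-! ### The central limit theorem for the score -/

/-- For `|x| ≤ 1` this is the exponential series remainder; for `|x| > 1` every term on the left is
at most a multiple of `|x| ^ 3`. -/
lemma norm_cexp_I_taylor_le (x : ℝ) :
    ‖Complex.exp (x * Complex.I) - 1 - x * Complex.I + x ^ 2 / 2‖ ≤ 4 * |x| ^ 3 := by
  have hn : ‖(x : ℂ) * Complex.I‖ = |x| := by simp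
  rcases le_or_gt |x| 1 with h | h
  · have := Complex.exp_bound (x := x * Complex.I) (by rwa [hn]) (n := 3) (by norm_num)
    rw [hn] at this
    have e : Complex.exp (x * Complex.I)
        - ∑ m ∈ Finset.range 3, (x * Complex.I) ^ m / (m.factorial : ℂ)
        = Complex.exp (x * Complex.I) - 1 - x * Complex.I + x ^ 2 / 2 := by
      simp [Finset.sum_range_succ, mul_pow]
      ring
    rw [e] at this
    refine this.trans ?_
    rw [mul_comm]
    gcongr
    norm_num [Nat.factorial]
  · have h1 : ‖Complex.exp (x * Complex.I)‖ = 1 := Complex.norm_exp_ofReal_mul_I x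
    have h2 : ‖(x : ℂ) ^ 2 / 2‖ = |x| ^ 2 / 2 := by simp
    calc ‖Complex.exp (x * Complex.I) - 1 - x * Complex.I + x ^ 2 / 2‖
        ≤ ‖Complex.exp (x * Complex.I)‖ + ‖(1 : ℂ)‖ + ‖(x : ℂ) * Complex.I‖
          + ‖(x : ℂ) ^ 2 / 2‖ :=
          (norm_add_le _ _).trans (add_le_add_left ((norm_sub_le _ _).trans
            (add_le_add_left (norm_sub_le _ _) _)) _)
      _ = 1 + 1 + |x| + |x| ^ 2 / 2 := by rw [h1, h2, hn, norm_one]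
      _ ≤ 4 * |x| ^ 3 := by
          generalize |x| = a at h
          have h2 : a ≤ a ^ 2 := by nlinarith
          have h3 : a ^ 2 ≤ a ^ 3 := by nlinarith
          linarith

/-- The mean of `exp (i l (Y - q))` for a Bernoulli variable `Y` with success probability `q`,
up to third order. -/
lemma norm_bernoulli_charFun_taylor_le {q : ℝ} (h0 : 0 ≤ q) (h1 : q ≤ 1) (l : ℝ) :
    ‖(q : ℂ) * Complex.exp (((1 - q) * l : ℝ) * Complex.I)
        + (1 - q) * Complex.exp ((-(q * l) : ℝ) * Complex.I) - 1 + (q * (1 - q) * l ^ 2 : ℝ) / 2‖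
      ≤ 8 * (q * |l| ^ 3) := by
  -- Expand both branches: the linear terms cancel because the variable is centred, and the
  -- quadratic ones add up to the variance.
  have e : (q : ℂ) * Complex.exp (((1 - q) * l : ℝ) * Complex.I)
        + (1 - q) * Complex.exp ((-(q * l) : ℝ) * Complex.I) - 1 + (q * (1 - q) * l ^ 2 : ℝ) / 2
      = (q : ℝ) * (Complex.exp (((1 - q) * l : ℝ) * Complex.I) - 1
          - ((1 - q) * l : ℝ) * Complex.I + (((1 - q) * l : ℝ) : ℂ) ^ 2 / 2)
        + ((1 - q : ℝ) : ℂ) * (Complex.exp ((-(q * l) : ℝ) * Complex.I) - 1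
          - (-(q * l) : ℝ) * Complex.I + ((-(q * l) : ℝ) : ℂ) ^ 2 / 2) := by
    push_cast; ring
  rw [e]
  refine (norm_add_le _ _).trans ?_
  rw [norm_mul, norm_mul, Complex.norm_of_nonneg h0, Complex.norm_of_nonneg (sub_nonneg.2 h1)]
  have a1 := norm_cexp_I_taylor_le ((1 - q) * l)
  have a2 := norm_cexp_I_taylor_le (-(q * l))
  rw [abs_mul, abs_of_nonneg (sub_nonneg.2 h1), mul_pow] at a1
  rw [abs_neg, abs_mul, abs_of_nonneg h0, mul_pow] at a2
  have b1 : (1 - q) ^ 3 ≤ 1 := pow_le_one₀ (by linarith) (by linarith)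
  -- The success branch carries `q` as its probability and the failure branch gains `q ^ 3 ≤ q`.
  -- This common factor `q` brings `e^α` into the error.
  have b2 : q ^ 3 ≤ q := pow_le_of_le_one h0 h1 (by norm_num)
  have c0 : 0 ≤ |l| ^ 3 := by positivity
  calc _ ≤ q * (4 * (1 * |l| ^ 3)) + 1 * (4 * (q * |l| ^ 3)) := by
        refine add_le_add (mul_le_mul_of_nonneg_left (a1.trans (by gcongr)) h0)
          (mul_le_mul (by linarith) (a2.trans (by gcongr)) (norm_nonneg _) zero_le_one)
    _ = _ := by ring

namespace IsLogisticSample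

variable {Ω : Type*} [MeasurableSpace Ω] {P : Measure Ω} {p N K : ℕ}
  {ν : Measure (EuclideanSpace ℝ (Fin p))} {θ : EuclideanSpace ℝ (Fin (p + 1))}
  {X : Fin N → Ω → EuclideanSpace ℝ (Fin p)} {Y : Fin N → Ω → ℝ} {c : Fin N → Ω → Fin K}

/-- The characteristic function of the contribution of one instance to the score. -/
noncomputable def scoreCharFun (ν : Measure (EuclideanSpace ℝ (Fin p)))
    (θ s : EuclideanSpace ℝ (Fin (p + 1))) : ℂ :=
  ∫ x, ((responseProb θ x : ℂ)
      * Complex.exp (((1 - responseProb θ x) * inner ℝ (augment x) s : ℝ) * Complex.I)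
    + (1 - responseProb θ x)
      * Complex.exp ((-(responseProb θ x * inner ℝ (augment x) s) : ℝ) * Complex.I)) ∂ν

lemma integral_cexp_score [IsProbabilityMeasure P] [IsProbabilityMeasure ν]
    (h : IsLogisticSample P ν θ X Y c) (i : Fin N) (s : EuclideanSpace ℝ (Fin (p + 1))) :
    ∫ ω, Complex.exp (((Y i ω - responseProb θ (X i ω)) * inner ℝ (augment (X i ω)) s : ℝ)
      * Complex.I) ∂P = scoreCharFun ν θ s := by
  have hmp := measurable_responseProb θ
  have hma := measurable_augment (p := p)
  have hinner : Measurable fun x : EuclideanSpace ℝ (Fin p) => inner ℝ (augment x) s :=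
    hma.inner measurable_const
  set u : EuclideanSpace ℝ (Fin p) → ℂ := fun x =>
    Complex.exp (((1 - responseProb θ x) * inner ℝ (augment x) s : ℝ) * Complex.I) with hu
  set v : EuclideanSpace ℝ (Fin p) → ℂ := fun x =>
    Complex.exp ((-(responseProb θ x * inner ℝ (augment x) s) : ℝ) * Complex.I) with hv
  have hum : Measurable u := by fun_prop
  have hvm : Measurable v := by fun_prop
  have hui : Integrable u ν := Integrable.of_bound hum.aestronglyMeasurable 1
    (ae_of_all _ fun x => (Complex.norm_exp_ofReal_mul_I _).le)
  have hvi : Integrable v ν := Integrable.of_bound hvm.aestronglyMeasurable 1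
    (ae_of_all _ fun x => (Complex.norm_exp_ofReal_mul_I _).le)
  -- On a binary response the exponential is affine in `Y`, so the tower property applies.
  have e : ∫ ω, Complex.exp (((Y i ω - responseProb θ (X i ω)) * inner ℝ (augment (X i ω)) s : ℝ)
      * Complex.I) ∂P = ∫ ω, (Y i ω • u (X i ω) + (v (X i ω) - Y i ω • v (X i ω))) ∂P := by
    refine integral_congr_ae ?_
    filter_upwards [h.binary_Y i] with ω hω
    rcases hω with h0 | h0 <;> simp [h0, hu, hv]
  have hpu := integrable_responseProb_smul θ hui
  have hpv := integrable_responseProb_smul θ hvi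
  have hdP : Integrable (fun ω => v (X i ω) - Y i ω • v (X i ω)) P :=
    (h.integrable_comp i hvi).sub (h.integrable_Y_smul i hvi)
  have hdν : Integrable (fun x => v x - responseProb θ x • v x) ν := hvi.sub hpv
  rw [e, integral_add (h.integrable_Y_smul i hui) hdP,
    integral_sub (h.integrable_comp i hvi) (h.integrable_Y_smul i hvi),
    h.integral_Y_smul i hum.stronglyMeasurable hui, h.integral_Y_smul i hvm.stronglyMeasurable hvi,
    h.integral_comp i hvi, ← integral_sub hvi hpv, ← integral_add hpu hdν]
  unfold scoreCharFun
  congr 1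
  ext x
  simp only [Complex.real_smul, hu, hv]
  ring

/-- Independence factorizes the characteristic function. The vector `s` plays the role of the
adjoint of `L` applied to `t`, so each factor depends on `L` and `t` only through `s`. -/
lemma charFun_score [IsProbabilityMeasure P] [IsProbabilityMeasure ν]
    (h : IsLogisticSample P ν θ X Y c) (t : EuclideanSpace ℝ (Fin (p + 1)))
    (L : EuclideanSpace ℝ (Fin (p + 1)) →ₗ[ℝ] EuclideanSpace ℝ (Fin (p + 1)))
    {s : EuclideanSpace ℝ (Fin (p + 1))} (hs : ∀ v, inner ℝ (L v) t = inner ℝ v s) :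
    charFun (P.map fun ω => L (weightedScore (fun i => augment (X i ω)) (fun i => Y i ω)
      (fun _ => 1) θ)) t = scoreCharFun ν θ s ^ N := by
  have hL : Measurable L := L.continuous_of_finiteDimensional.measurable
  have hmp := measurable_responseProb θ
  have hma := measurable_augment (p := p)
  set V : Fin N → Ω → EuclideanSpace ℝ (Fin (p + 1)) := fun i ω =>
    (Y i ω - responseProb θ (X i ω)) • L (augment (X i ω)) with hV
  have hVm : ∀ i, Measurable (V i) := fun i => by
    have hX := h.measurable_X i
    have hY := h.measurable_Y i
    fun_prop
  have hindep : iIndepFun V P := by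
    refine h.indep.comp (fun _ q => (q.1.2 - responseProb θ q.1.1) • L (augment q.1.1)) fun i => ?_
    fun_prop
  have e : (fun ω => L (weightedScore (fun i => augment (X i ω)) (fun i => Y i ω)
      (fun _ => 1) θ)) = fun ω => ∑ i, V i ω := by
    ext1 ω
    simp [weightedScore, hV, map_sum, map_smul, responseProb_eq_logistic]
  rw [e, hindep.charFun_map_fun_sum_eq_prod fun i => (hVm i).aemeasurable, Finset.prod_apply]
  have : ∀ i, charFun (P.map (V i)) t = scoreCharFun ν θ s := fun i => by
    rw [charFun_apply, integral_map (hVm i).aemeasurable (by fun_prop), ← h.integral_cexp_score i s]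
    congr 1
    ext ω
    simp only [hV, inner_smul_left, hs, conj_trivial]
  simp [this]

end IsLogisticSample

/-- By `(1 + z_N / N)^N → e^z` it suffices to find the limit of `N (φ_N - 1)`. The second-order term
is the scaled information, which converges to the quadratic form of `Σ*`; the third-order error is
bounded through the envelope. -/
lemma tendsto_scoreCharFun_pow {p : ℕ} {ν : Measure (EuclideanSpace ℝ (Fin p))}
    [IsProbabilityMeasure ν] {β : EuclideanSpace ℝ (Fin p)} (henv : Integrable (envelope β) ν)
    {α : ℕ → ℝ} (hα : Tendsto α atTop atBot)
    (hαN : Tendsto (fun N : ℕ => α N + Real.log N) atTop atTop)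
    (s : EuclideanSpace ℝ (Fin (p + 1))) :
    Tendsto (fun N : ℕ => IsLogisticSample.scoreCharFun ν (paramOf (α N) β)
      ((√(N * Real.exp (α N)))⁻¹ • s) ^ N) atTop
      (𝓝 (Complex.exp (-(s.ofLp ⬝ᵥ (sigmaStar ν β).mulVec s.ofLp : ℝ) / 2))) := by
  have hr := tendsto_mul_exp_atTop hαN
  have hma := measurable_augment (p := p)
  have hinner : Measurable fun x : EuclideanSpace ℝ (Fin p) => inner ℝ (augment x) s :=
    hma.inner measurable_const
  suffices H : Tendsto (fun N : ℕ => (N : ℂ) * (IsLogisticSample.scoreCharFun ν (paramOf (α N) β)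
      ((√(N * Real.exp (α N)))⁻¹ • s) - 1)) atTop
      (𝓝 (-(s.ofLp ⬝ᵥ (sigmaStar ν β).mulVec s.ofLp : ℝ) / 2)) by
    simpa using Complex.tendsto_one_add_pow_exp_of_tendsto H
  have hvar := tendsto_scaled_information (ν := ν) (β := β) hα
    (f := fun x => inner ℝ (augment x) s ^ 2) (by fun_prop) (integrable_exp_mul_inner_sq henv s)
  rw [← dotProduct_sigmaStar henv] at hvar
  have hvar' := ((Complex.continuous_ofReal.tendsto _).comp hvar).neg.div_const (2 : ℂ)
  refine tendsto_of_tendsto_of_dist hvar' ?_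
  have hsq : Tendsto (fun N : ℕ => 8 * ‖s‖ ^ 3 * (∫ x, envelope β x ∂ν)
      * (√(N * Real.exp (α N)))⁻¹) atTop (𝓝 0) := by
    simpa using (tendsto_inv_atTop_zero.comp (Real.tendsto_sqrt_atTop.comp hr)).const_mul
      (8 * ‖s‖ ^ 3 * (∫ x, envelope β x ∂ν))
  refine squeeze_zero' (Eventually.of_forall fun _ => dist_nonneg) ?_ hsq
  filter_upwards [eventually_gt_atTop 0] with N hN
  have hr : (0 : ℝ) < N * Real.exp (α N) := by positivity
  set r : ℝ := N * Real.exp (α N) with hrdef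
  have hsr : 0 < √r := Real.sqrt_pos.2 hr
  have hss : √r ^ 2 = r := Real.sq_sqrt hr.le
  set θ := paramOf (α N) β
  have hmp := measurable_responseProb θ
  set l : EuclideanSpace ℝ (Fin p) → ℝ := fun x => inner ℝ (augment x) ((√r)⁻¹ • s)
  have hlm : Measurable l := hma.inner measurable_const
  have hle : ∀ x, l x = (√r)⁻¹ * inner ℝ (augment x) s := fun x => inner_smul_right _ _ _
  set w : EuclideanSpace ℝ (Fin p) → ℂ := fun x => (responseProb θ x : ℂ)
      * Complex.exp (((1 - responseProb θ x) * l x : ℝ) * Complex.I)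
    + (1 - responseProb θ x) * Complex.exp ((-(responseProb θ x * l x) : ℝ) * Complex.I)
  have hwm : Measurable w := by fun_prop
  have hwi : Integrable w ν := by
    refine Integrable.of_bound hwm.aestronglyMeasurable 2 (ae_of_all _ fun x => ?_)
    have h0 := responseProb_pos θ x
    have h1 := responseProb_lt_one θ x
    refine (norm_add_le _ _).trans ?_
    rw [norm_mul, norm_mul, Complex.norm_exp_ofReal_mul_I, Complex.norm_exp_ofReal_mul_I,
      Complex.norm_of_nonneg h0.le, ← Complex.ofReal_one, ← Complex.ofReal_sub,
      Complex.norm_of_nonneg (sub_nonneg.2 h1.le)]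
    linarith
  have hq : Integrable (fun x => responseProb θ x * (1 - responseProb θ x) * l x ^ 2) ν := by
    refine ((integrable_exp_mul_inner_sq henv s).const_mul
      (Real.exp (α N) * (√r)⁻¹ ^ 2)).mono' (by fun_prop) (ae_of_all _ fun x => ?_)
    have h0 := responseProb_pos θ x
    have h1 := sub_pos.2 (responseProb_lt_one θ x)
    rw [Real.norm_of_nonneg (by positivity), hle, mul_pow]
    calc _ ≤ Real.exp (α N) * Real.exp (inner ℝ x β) * 1
          * ((√r)⁻¹ ^ 2 * inner ℝ (augment x) s ^ 2) := by
          gcongr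
          · exact responseProb_paramOf_le _ _ _
          · linarith
      _ = _ := by ring
  have hmain : ‖∫ x, (w x - 1 + (responseProb θ x * (1 - responseProb θ x) * l x ^ 2 : ℝ) / 2) ∂ν‖
      ≤ 8 * ((√r)⁻¹ ^ 3 * ‖s‖ ^ 3 * Real.exp (α N)) * ∫ x, envelope β x ∂ν := by
    rw [← integral_const_mul]
    refine norm_integral_le_of_norm_le (henv.const_mul _) (ae_of_all _ fun x => ?_)
    refine (norm_bernoulli_charFun_taylor_le (responseProb_pos θ x).le
      (responseProb_lt_one θ x).le (l x)).trans ?_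
    rw [mul_assoc]
    refine mul_le_mul_of_nonneg_left ?_ (by norm_num)
    rw [hle, abs_mul, abs_of_pos (inv_pos.2 hsr)]
    calc responseProb θ x * ((√r)⁻¹ * |inner ℝ (augment x) s|) ^ 3
        ≤ Real.exp (α N) * Real.exp (inner ℝ x β) * ((√r)⁻¹ * (‖augment x‖ * ‖s‖)) ^ 3 := by
          gcongr
          · exact responseProb_paramOf_le _ _ _
          · exact abs_real_inner_le_norm _ _
      _ = (√r)⁻¹ ^ 3 * ‖s‖ ^ 3 * Real.exp (α N)
          * (Real.exp (inner ℝ x β) * ‖augment x‖ ^ 3) := by ring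
      _ ≤ _ := by
          gcongr
          exact exp_inner_mul_le_envelope β x le_rfl
  have hq' : Integrable (fun x =>
      ((responseProb θ x * (1 - responseProb θ x) * l x ^ 2 : ℝ) : ℂ) / 2) ν := hq.ofReal.div_const 2
  have hint : ∫ x, (w x - 1 + (responseProb θ x * (1 - responseProb θ x) * l x ^ 2 : ℝ) / 2) ∂ν
      = IsLogisticSample.scoreCharFun ν θ ((√r)⁻¹ • s) - 1
        + ((r⁻¹ * ∫ x, responseProb θ x * (1 - responseProb θ x)
          * inner ℝ (augment x) s ^ 2 ∂ν : ℝ) : ℂ) / 2 := by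
    have hw1 : Integrable (fun x => w x - 1) ν := hwi.sub (integrable_const 1)
    rw [integral_add hw1 hq', integral_sub hwi (integrable_const 1),
      integral_div, integral_complex_ofReal, ← integral_const_mul]
    congr 1
    · simp; rfl
    · congr 3
      ext x
      rw [hle, mul_pow, inv_pow, hss]
      ring
  rw [hint] at hmain
  rw [dist_comm, dist_eq_norm]
  have hN' : (N : ℝ) ≠ 0 := by positivity
  have e : (N : ℂ) * (IsLogisticSample.scoreCharFun ν θ ((√r)⁻¹ • s) - 1)
      - -(((Real.exp (α N))⁻¹ * ∫ x, responseProb θ x * (1 - responseProb θ x)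
          * inner ℝ (augment x) s ^ 2 ∂ν : ℝ) : ℂ) / 2
      = (N : ℂ) * (IsLogisticSample.scoreCharFun ν θ ((√r)⁻¹ • s) - 1
        + ((r⁻¹ * ∫ x, responseProb θ x * (1 - responseProb θ x)
          * inner ℝ (augment x) s ^ 2 ∂ν : ℝ) : ℂ) / 2) := by
    have : (Real.exp (α N))⁻¹ = N * r⁻¹ := by rw [hrdef]; field_simp
    rw [this]
    push_cast
    ring
  refine le_of_eq_of_le (congrArg norm e) ?_
  rw [norm_mul, Complex.norm_natCast]
  -- One factor `N e^α = r` against `r^{-3/2}` leaves `r^{-1/2}`.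
  calc N * _ ≤ N * (8 * ((√r)⁻¹ ^ 3 * ‖s‖ ^ 3 * Real.exp (α N)) * ∫ x, envelope β x ∂ν) := by
        gcongr
    _ = 8 * ‖s‖ ^ 3 * (∫ x, envelope β x ∂ν) * (r * (√r)⁻¹ ^ 3) := by rw [hrdef]; ring
    _ = _ := by
        have : r * (√r)⁻¹ ^ 3 = (√r)⁻¹ := by
          have h : r * (√r)⁻¹ ^ 3 = √r ^ 2 * (√r)⁻¹ ^ 3 := by rw [hss]
          rw [h]; field_simp
        rw [this]

lemma inner_toEuclideanLin_comm {d : ℕ} {S : Matrix (Fin d) (Fin d) ℝ} (hS : S.IsHermitian)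
    (u v : EuclideanSpace ℝ (Fin d)) :
    inner ℝ (Matrix.toEuclideanLin S u) v = inner ℝ u (Matrix.toEuclideanLin S v) :=
  (Matrix.isSymmetric_toEuclideanLin_iff.2 hS) u v

/-- The central limit theorem for the linear term of the representation. -/
theorem tendstoInDistribution_score {Ω : Type*} [MeasurableSpace Ω] (P : Measure Ω)
    [IsProbabilityMeasure P]
    {p : ℕ} (ν : Measure (EuclideanSpace ℝ (Fin p))) [IsProbabilityMeasure ν]
    (α : ℕ → ℝ) (β : EuclideanSpace ℝ (Fin p)) (K : ℕ → ℕ)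
    (X : (N : ℕ) → Fin N → Ω → EuclideanSpace ℝ (Fin p)) (Y : (N : ℕ) → Fin N → Ω → ℝ)
    (c : (N : ℕ) → Fin N → Ω → Fin (K N))
    (hsample : ∀ N, IsLogisticSample P ν (paramOf (α N) β) (X N) (Y N) (c N))
    (henv : Integrable (envelope β) ν)
    (hα : Tendsto α atTop atBot)
    (hαN : Tendsto (fun N : ℕ => α N + Real.log N) atTop atTop)
    (hS : IsUnit (sigmaStar ν β)) :
    TendstoInDistribution
      (fun (N : ℕ) ω => (√(N * Real.exp (α N)))⁻¹ • Matrix.toEuclideanLin (sigmaStar ν β)⁻¹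
        (gradient (globalLogLik (fun i => X N i ω) (fun i => Y N i ω)) (paramOf (α N) β)))
      atTop id (fun _ => P) (multivariateGaussian 0 (sigmaStar ν β)⁻¹) := by
  have hpd := posDef_sigmaStar henv hS
  have hLm : Measurable (Matrix.toEuclideanLin (sigmaStar ν β)⁻¹) :=
    (Matrix.toEuclideanLin (sigmaStar ν β)⁻¹).continuous_of_finiteDimensional.measurable
  have hmeas : ∀ N, Measurable (fun ω => (√(N * Real.exp (α N)))⁻¹ •
      Matrix.toEuclideanLin (sigmaStar ν β)⁻¹ (gradient (globalLogLik (fun i => X N i ω)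
        (fun i => Y N i ω)) (paramOf (α N) β))) := by
    intro N
    simp_rw [gradient_globalLogLik, weightedScore, ← responseProb_eq_logistic]
    refine Measurable.const_smul (hLm.comp (Finset.measurable_fun_sum _ fun i _ => ?_))
      (√(N * Real.exp (α N)))⁻¹
    have hX := (hsample N).measurable_X i
    have hY := (hsample N).measurable_Y i
    have hmp := measurable_responseProb (paramOf (α N) β)
    have hma := measurable_augment (p := p)
    fun_prop
  refine ⟨fun N => (hmeas N).aemeasurable, aemeasurable_id, ?_⟩
  refine ProbabilityMeasure.tendsto_iff_tendsto_charFun.2 fun t => ?_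
  -- As `Σ*⁻¹` is symmetric, testing against `t` amounts to testing the raw score against `s = Σ*⁻¹
  -- t`, and `sᵀ Σ* s = tᵀ Σ*⁻¹ t`.
  set s := Matrix.toEuclideanLin (sigmaStar ν β)⁻¹ t with hs
  have hlim : charFun ((multivariateGaussian 0 (sigmaStar ν β)⁻¹).map id) t
      = Complex.exp (-(s.ofLp ⬝ᵥ (sigmaStar ν β).mulVec s.ofLp : ℝ) / 2) := by
    rw [Measure.map_id, charFun_multivariateGaussian hpd.inv.posSemidef]
    congr 1
    have e1 : s.ofLp ⬝ᵥ (sigmaStar ν β).mulVec s.ofLp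
        = t.ofLp ⬝ᵥ ((sigmaStar ν β)⁻¹).mulVec t.ofLp := by
      rw [← inner_toEuclideanLin_self, ← inner_toEuclideanLin_self, hs,
        toEuclideanLin_inv_apply hS, real_inner_comm]
    rw [e1, inner_zero_right]
    simp
    ring
  have h := tendsto_scoreCharFun_pow henv hα hαN s
  rw [← hlim] at h
  refine h.congr fun N => ?_
  have hchar := (hsample N).charFun_score t
    ((√(N * Real.exp (α N)))⁻¹ • Matrix.toEuclideanLin (sigmaStar ν β)⁻¹)
    (s := (√(N * Real.exp (α N)))⁻¹ • s) fun v => by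
      rw [LinearMap.smul_apply, inner_smul_left, inner_smul_right,
        inner_toEuclideanLin_comm hpd.inv.isHermitian, conj_trivial]
  rw [← hchar]
  simp_rw [gradient_globalLogLik]
  rfl

/-! ### Linear representations and limit laws of both estimators -/

theorem theorem3 {Ω : Type*} [MeasurableSpace Ω] (P : Measure Ω) [IsProbabilityMeasure P]
    {p : ℕ} (ν : Measure (EuclideanSpace ℝ (Fin p))) [IsProbabilityMeasure ν]
    (α : ℕ → ℝ) (β : EuclideanSpace ℝ (Fin p)) (K : ℕ → ℕ) (hK : ∀ N, 0 < K N)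
    (X : (N : ℕ) → Fin N → Ω → EuclideanSpace ℝ (Fin p)) (Y : (N : ℕ) → Fin N → Ω → ℝ)
    (c : (N : ℕ) → Fin N → Ω → Fin (K N))
    (hsample : ∀ N, IsLogisticSample P ν (paramOf (α N) β) (X N) (Y N) (c N))
    -- (C1): sub-Gaussian tails of the augmented covariate
    (CTail : ℝ) (hCTail : 0 < CTail)
    (hC1 : ∀ M : ℝ, 0 ≤ M → ν.real {x | M < ‖augment x‖} ≤ 2 * Real.exp (-CTail * M ^ 2))
    -- (C2): the expected local sample size `n = N / K` diverges
    (hC2 : Tendsto (fun N : ℕ => (N : ℝ) / K N) atTop atTop)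
    -- (C3): `log² N / (n e^α) = O(1)`
    (hC3 : (fun N : ℕ => Real.log N ^ 2 / ((N : ℝ) / K N * Real.exp (α N))) =O[atTop]
      (fun _ => (1 : ℝ)))
    -- rare events
    (hα : Tendsto α atTop atBot)
    (hαN : Tendsto (fun N : ℕ => α N + Real.log N) atTop atTop)
    -- on a local computer the positives do not outnumber the negatives in order of magnitude
    (hratio : (fun N : ℕ => (K N : ℝ) * Real.exp (α N)) =O[atTop] (fun _ => (1 : ℝ)))
    -- `Σ*` is invertible
    (hS : IsUnit (sigmaStar ν β))
    -- the local IPW estimators and the global maximum likelihood estimator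
    (θloc : (N : ℕ) → Fin (K N) → Ω → EuclideanSpace ℝ (Fin (p + 1)))
    (hθloc : ∀ N k, IsArgmaxEstimator P
      (fun ω => ipwObjective (fun i => X N i ω) (fun i => Y N i ω) (fun i => c N i ω) k)
      (θloc N k))
    (θgmle : ℕ → Ω → EuclideanSpace ℝ (Fin (p + 1)))
    (hθgmle : ∀ N, IsArgmaxEstimator P
      (fun ω => globalLogLik (fun i => X N i ω) (fun i => Y N i ω)) (θgmle N)) :
    -- the asymptotic linear representation of the IPW estimator
    TendstoInMeasure P
      (fun (N : ℕ) ω =>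
        √(N * Real.exp (α N)) • (oneShot (fun k => θloc N k ω) - paramOf (α N) β)
          - (√(N * Real.exp (α N)))⁻¹ • Matrix.toEuclideanLin (sigmaStar ν β)⁻¹
              (gradient (globalLogLik (fun i => X N i ω) (fun i => Y N i ω)) (paramOf (α N) β)))
      atTop (fun _ => 0)
    -- the same representation for the global maximum likelihood estimator
    ∧ TendstoInMeasure P
      (fun (N : ℕ) ω =>
        √(N * Real.exp (α N)) • (θgmle N ω - paramOf (α N) β)
          - (√(N * Real.exp (α N)))⁻¹ • Matrix.toEuclideanLin (sigmaStar ν β)⁻¹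
              (gradient (globalLogLik (fun i => X N i ω) (fun i => Y N i ω)) (paramOf (α N) β)))
      atTop (fun _ => 0)
    -- both estimators have the same asymptotic distribution, `N(0, Σ*⁻¹)`
    ∧ TendstoInDistribution
      (fun (N : ℕ) ω =>
        √(N * Real.exp (α N)) • (oneShot (fun k => θloc N k ω) - paramOf (α N) β))
      atTop id (fun _ => P) (multivariateGaussian 0 (sigmaStar ν β)⁻¹)
    ∧ TendstoInDistribution
      (fun (N : ℕ) ω => √(N * Real.exp (α N)) • (θgmle N ω - paramOf (α N) β))
      atTop id (fun _ => P) (multivariateGaussian 0 (sigmaStar ν β)⁻¹) := by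
  have henv := integrable_envelope hCTail hC1 β
  have henv2 := integrable_envelope_sq hCTail hC1 β
  have h1 := ipw_linear_representation P ν α β K hK X Y c hsample henv henv2 hC3 hα hratio hS
    θloc hθloc
  have h2 := gmle_linear_representation P ν α β K hK X Y c hsample henv henv2 hC3 hα hratio hS
    θgmle hθgmle
  have h3 := tendstoInDistribution_score P ν α β K X Y c hsample henv hα hαN hS
  refine ⟨h1, h2, ?_, ?_⟩
  -- Slutsky: a sequence differing by `o_p(1)` from the linear term shares its limit law.
  · refine tendstoInDistribution_of_tendstoInMeasure_sub _ _ h3 h1 fun N => ?_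
    have := fun k => (hθloc N k).1
    unfold oneShot
    fun_prop
  · refine tendstoInDistribution_of_tendstoInMeasure_sub _ _ h3 h2 fun N => ?_
    have := (hθgmle N).1
    fun_prop
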